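/- **Conventions.** An operad of simplicial sets is nonsymmetric: simplicial sets $\mathcal O(n)$, $n\ge 0$, with a unit in $\mathcal O(1)$ and simplicial composition maps $\mathcal O(n)\times\mathcal O(m_1)\times\cdots\times\mathcal O(m_n)\to\mathcal O(m_1+\cdots+m_n)$ that are unital and associative; a morphism of operads consists of simplicial maps in each arity that preserve the unit and the compositions. It is an $A_\infty$-operad if every $\mathcal O(n)$, $n\ge 0$, is (weakly) contractible. Let $(\mathcal E,\diamond,I)$ be a complete and cocomplete monoidal category (no compatibility between $\diamond$ and limits or colimits is assumed). Let $c\mathcal E$ be the category of cosimplicial objects in $\mathcal E$, with the levelwise monoidal structure $\diamond$. For a simplicial set $S$ and $Y\in c\mathcal E$ let $[S,Y]\in c\mathcal E$ be the cosimplicial object $[S,Y]^j=\prod_{S_j}Y^j$, and let $\operatorname{map}_{c\mathcal E}(X,Y)$ be the simplicial set with $\operatorname{map}_{c\mathcal E}(X,Y)_k=\operatorname{Hom}_{c\mathcal E}(X,[\Delta[k],Y])$ (the external simplicial structure). So a $k$-simplex of $\operatorname{map}_{c\mathcal E}(X,Y)$ is a family of morphisms $\varphi^j(\sigma)\colon X^j\to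 Y^j$, for $j\ge 0$ and $\sigma\in\Delta[k]_j$, compatible with the cosimplicial structure maps; composition and $\diamond$ of $k$-simplices are formed separately for each $j$ and $\sigma$. For $X\in c\mathcal E$ the endomorphism operad $\mathrm{End}(X)$ has $\mathrm{End}(X)(n)=\operatorname{map}_{c\mathcal E}(X^{\diamond n},X)$, with unit $\mathrm{id}_X$ and composition $(x;y_1,\dots,y_n)\mapsto x\circ(y_1\diamond\cdots\diamond y_n)$. Let $(K,\eta,\mu)$ be a monoid in $\mathcal E$. Its cobar construction $R_K\in c\mathcal E$ has $R_K^n=K^{\diamond(n+1)}$; the $i$-th coface inserts $\eta$ at position $i$ (so that $i$ factors $K$ stand to its left), and the $i$-th codegeneracy multiplies the factors in positions $i$ and $i+1$ by $\mu$ (positions counted from $0$). A twist map for $K$ is a morphism $t\colon K\diamond K\to K\diamond K$ such that (suppressing the associativity and unit isomorphisms) 1. $\mu\circ t=\mu$; 2. $t\circ(K\diamond\eta)=\eta\diamond K$ and $t\circ(\eta\diamond K)=K\diamond\eta$; 3. $t\circ(\mu\diamond K)=(K\diamond\mu)\circ(t\diamond K)\circ(K\diamond t)$ and $t\circ(K\diamond\mu)=(\mu\diamond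 K)\circ(K\diamond t)\circ(t\diamond K)$. **Theorem 1.2.** There exists an $A_\infty$-operad $\mathrm{TW}$ of simplicial sets such that for every complete and cocomplete monoidal category $\mathcal E$, every monoid $(K,\eta,\mu)$ in $\mathcal E$ and every twist map $t$ for $K$, the cobar construction $R_K$ is a $\mathrm{TW}$-algebra in $c\mathcal E$, i.e. there is a morphism of operads $\mathrm{TW}\to\mathrm{End}(R_K)$. -/

import Mathlib

open CategoryTheory MonoidalCategory Limits Opposite

universe v u

namespace TwistOperad

universe w w'

section Tensor

variable {E : Type u} [Category.{v} E] [MonoidalCategory E]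

/-- The tensor product `B 0 ⊗ (B 1 ⊗ (⋯ ⊗ (B (n - 1) ⊗ 𝟙_ E)))` of a finite family of objects. -/
def finTensor : (n : ℕ) → (Fin n → E) → E
  | 0, _ => 𝟙_ E
  | n + 1, B => B 0 ⊗ finTensor n (fun i => B i.succ)

/-- The tensor product of a finite family of morphisms. -/
def finTensorMap : {n : ℕ} → {B B' : Fin n → E} → (∀ i, B i ⟶ B' i) →
    (finTensor n B ⟶ finTensor n B')
  | 0, _, _, _ => 𝟙 (𝟙_ E)
  | _ + 1, _, _, g => g 0 ⊗ₘ finTensorMap (fun i => g i.succ)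

lemma finTensorMap_id : ∀ {n : ℕ} (B : Fin n → E),
    finTensorMap (fun i => 𝟙 (B i)) = 𝟙 (finTensor n B)
  | 0, _ => rfl
  | n + 1, B => by
    change 𝟙 (B 0) ⊗ₘ finTensorMap (fun i : Fin n => 𝟙 (B i.succ)) = _
    rw [finTensorMap_id]
    exact id_tensorHom_id _ _

lemma finTensorMap_comp : ∀ {n : ℕ} {B B' B'' : Fin n → E} (g : ∀ i, B i ⟶ B' i)
    (h : ∀ i, B' i ⟶ B'' i),
    finTensorMap (fun i => g i ≫ h i) = finTensorMap g ≫ finTensorMap h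
  | 0, _, _, _, _, _ => (Category.comp_id _).symm
  | n + 1, _, _, _, g, h => by
    change (g 0 ≫ h 0) ⊗ₘ finTensorMap (fun i : Fin n => g i.succ ≫ h i.succ) = _
    rw [finTensorMap_comp]
    exact (tensorHom_comp_tensorHom _ _ _ _).symm

/-- The `n`-th tensor power of an object. -/
abbrev tensorPow (A : E) (n : ℕ) : E := finTensor n (fun _ => A)

/-- The list of letters of a bracketed word. -/
def letters {ι : Type} : FreeMonoidalCategory ι → List ι
  | .of i => [i]
  | .unit => []
  | .tensor X Y => letters X ++ letters Y

lemma normalizeObj_eq_foldl {ι : Type} : ∀ (X : FreeMonoidalCategory ι)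
    (N : FreeMonoidalCategory.NormalMonoidalObject ι),
    FreeMonoidalCategory.normalizeObj X N = (letters X).foldl .tensor N
  | .of _, _ => rfl
  | .unit, _ => rfl
  | .tensor X Y, N => by
    simp only [FreeMonoidalCategory.normalizeObj, letters, List.foldl_append]
    rw [normalizeObj_eq_foldl X, normalizeObj_eq_foldl Y]

lemma nonempty_hom_of_letters_eq {ι : Type} {X Y : FreeMonoidalCategory ι}
    (h : letters X = letters Y) : Nonempty (X ⟶ Y) := by
  have h' : (FreeMonoidalCategory.fullNormalize ι).obj X =
      (FreeMonoidalCategory.fullNormalize ι).obj Y := by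
    apply Discrete.ext
    change FreeMonoidalCategory.normalizeObj X .unit = FreeMonoidalCategory.normalizeObj Y .unit
    rw [normalizeObj_eq_foldl, normalizeObj_eq_foldl, h]
  exact ⟨(FreeMonoidalCategory.fullNormalizeIso ι).hom.app X ≫
    eqToHom (congrArg FreeMonoidalCategory.inclusion.obj h') ≫
    (FreeMonoidalCategory.fullNormalizeIso ι).inv.app Y⟩

lemma letters_finTensor {ι : Type} : ∀ (n : ℕ) (W : Fin n → FreeMonoidalCategory ι),
    letters (finTensor n W) = (List.ofFn fun i => letters (W i)).flatten
  | 0, _ => rfl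
  | n + 1, W => by
    rw [List.ofFn_succ, List.flatten_cons, ← letters_finTensor n]
    rfl

lemma ofFn_finSigmaFinEquiv {α : Type} : ∀ (n : ℕ) (m : Fin n → ℕ)
    (f : (Σ i, Fin (m i)) → α),
    List.ofFn (fun l => f (finSigmaFinEquiv.symm l)) =
      (List.ofFn fun i => List.ofFn fun j => f ⟨i, j⟩).flatten
  | 0, m, f => by simp
  | n + 1, m, f => by
    rw [List.ofFn_succ', List.concat_eq_append, List.flatten_append,
      ← ofFn_finSigmaFinEquiv n (fun i => m i.castSucc) (fun s => f ⟨s.1.castSucc, s.2⟩)]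
    rw [List.ofFn_congr (Fin.sum_univ_castSucc m), List.ofFn_add]
    simp only [List.flatten_cons, List.flatten_nil, List.append_nil]
    congr 1
    · congr 1
      funext l
      congr 1
      rw [Equiv.symm_apply_eq]
      apply Fin.ext
      obtain ⟨s, rfl⟩ := finSigmaFinEquiv.surjective l
      rw [Equiv.symm_apply_apply, finSigmaFinEquiv_apply]
      simp [finSigmaFinEquiv_apply]
    · congr 1
      funext l
      congr 1
      rw [Equiv.symm_apply_eq]
      apply Fin.ext
      rw [finSigmaFinEquiv_apply]
      simp
      rfl

/-- The tensor product of bracketed words is compatible with the evaluation of words. -/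
def projectFinTensor {ι : Type} (B : ι → E) : (n : ℕ) → (W : Fin n → FreeMonoidalCategory ι) →
    ((FreeMonoidalCategory.project B).obj (finTensor n W) ≅
      finTensor n (fun i => (FreeMonoidalCategory.project B).obj (W i)))
  | 0, _ => Iso.refl (𝟙_ E)
  | n + 1, W => whiskerLeftIso ((FreeMonoidalCategory.project B).obj (W 0))
      (projectFinTensor B n (fun i => W i.succ))

/-- The word `⊗_l l` in the letters `(i, j)`, in lexicographic order. -/
abbrev flatWord {n : ℕ} (m : Fin n → ℕ) : FreeMonoidalCategory (Σ i, Fin (m i)) :=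
  finTensor (∑ i, m i) (fun l => .of (finSigmaFinEquiv.symm l))

/-- The word `⊗_i ⊗_j (i, j)`. -/
abbrev nestedWord {n : ℕ} (m : Fin n → ℕ) : FreeMonoidalCategory (Σ i, Fin (m i)) :=
  finTensor n (fun i => finTensor (m i) (fun j => .of ⟨i, j⟩))

/-- The formal rebracketing morphism. It is unique, by Mac Lane's coherence theorem. -/
noncomputable def flatToNested {n : ℕ} (m : Fin n → ℕ) : flatWord m ⟶ nestedWord m :=
  Classical.choice <| nonempty_hom_of_letters_eq <| by
    simp only [letters_finTensor, letters]
    rw [ofFn_finSigmaFinEquiv n m (fun s => [s]), List.flatten_flatten, List.map_ofFn]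
    rfl

/-- The canonical rebracketing (built from associators and unitors)
`⊗_l B l ⟶ ⊗_i ⊗_j B (i, j)`, where `l` runs over the pairs `(i, j)` in lexicographic order. -/
noncomputable def regroup {n : ℕ} (m : Fin n → ℕ) (B : (Σ i, Fin (m i)) → E) :
    finTensor (∑ i, m i) (fun l => B (finSigmaFinEquiv.symm l)) ⟶
      finTensor n (fun i => finTensor (m i) (fun j => B ⟨i, j⟩)) :=
  (projectFinTensor B (∑ i, m i) (fun l => .of (finSigmaFinEquiv.symm l))).inv ≫
    (FreeMonoidalCategory.project B).map (flatToNested m) ≫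
    (projectFinTensor B n (fun i => finTensor (m i) (fun j => .of ⟨i, j⟩))).hom ≫
    finTensorMap (fun i => (projectFinTensor B (m i) (fun j => .of ⟨i, j⟩)).hom)

section Coherence

open FreeMonoidalCategory (project)

lemma project_map_whiskerLeft {ι : Type*} (B : ι → E) (X : FreeMonoidalCategory ι)
    {Y Z : FreeMonoidalCategory ι} (f : Y ⟶ Z) :
    (project B).map (X ◁ f) = (project B).obj X ◁ (project B).map f := by
  obtain ⟨f⟩ := f
  rfl

lemma project_map_whiskerRight {ι : Type*} (B : ι → E) (X : FreeMonoidalCategory ι)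
    {Y Z : FreeMonoidalCategory ι} (f : Y ⟶ Z) :
    (project B).map (f ▷ X) = (project B).map f ▷ (project B).obj X := by
  obtain ⟨f⟩ := f
  rfl

lemma project_map_tensorHom {ι : Type*} (B : ι → E)
    {X Y Z T : FreeMonoidalCategory ι} (f : X ⟶ Y) (g : Z ⟶ T) :
    (project B).map (f ⊗ₘ g) = (project B).map f ⊗ₘ (project B).map g := by
  obtain ⟨f⟩ := f
  obtain ⟨g⟩ := g
  rfl

/-- A family of morphisms of `E` extends to words. -/
def wordMap {ι : Type} {B B' : ι → E} (g : ∀ i, B i ⟶ B' i) : (X : FreeMonoidalCategory ι) →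
    ((project B).obj X ⟶ (project B').obj X)
  | .of i => g i
  | .unit => 𝟙 (𝟙_ E)
  | .tensor X Y => wordMap g X ⊗ₘ wordMap g Y

lemma wordMap_naturality {ι : Type} {B B' : ι → E} (g : ∀ i, B i ⟶ B' i)
    {X Y : FreeMonoidalCategory ι} (f : X ⟶ Y) :
    (project B).map f ≫ wordMap g Y = wordMap g X ≫ (project B').map f := by
  induction f using FreeMonoidalCategory.Hom.inductionOn with
  | id X => simp
  | α_hom X Y Z => exact (associator_naturality _ _ _).symm
  | α_inv X Y Z => exact (associator_inv_naturality _ _ _).symm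
  | l_hom X =>
    change (λ_ _).hom ≫ wordMap g X = (𝟙 (𝟙_ E) ⊗ₘ wordMap g X) ≫ (λ_ _).hom
    simp
  | l_inv X =>
    change (λ_ _).inv ≫ (𝟙 (𝟙_ E) ⊗ₘ wordMap g X) = wordMap g X ≫ (λ_ _).inv
    simp
  | ρ_hom X =>
    change (ρ_ _).hom ≫ wordMap g X = (wordMap g X ⊗ₘ 𝟙 (𝟙_ E)) ≫ (ρ_ _).hom
    simp
  | ρ_inv X =>
    change (ρ_ _).inv ≫ (wordMap g X ⊗ₘ 𝟙 (𝟙_ E)) = wordMap g X ≫ (ρ_ _).inv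
    simp
  | comp f h hf hh =>
    rw [Functor.map_comp, Functor.map_comp, Category.assoc, hh, reassoc_of% hf]
  | @whiskerLeft X Y Z f hf =>
    rw [project_map_whiskerLeft, project_map_whiskerLeft]
    change _ ◁ (project B).map f ≫ (wordMap g X ⊗ₘ wordMap g Z) =
      (wordMap g X ⊗ₘ wordMap g Y) ≫ _ ◁ (project B').map f
    rw [whiskerLeft_comp_tensorHom, tensorHom_comp_whiskerLeft, hf]
  | @whiskerRight Y Z f X hf =>
    rw [project_map_whiskerRight, project_map_whiskerRight]
    change (project B).map f ▷ _ ≫ (wordMap g Z ⊗ₘ wordMap g X) =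
      (wordMap g Y ⊗ₘ wordMap g X) ≫ (project B').map f ▷ _
    rw [whiskerRight_comp_tensorHom, tensorHom_comp_whiskerRight, hf]

lemma wordMap_finTensor {ι : Type} {B B' : ι → E} (g : ∀ i, B i ⟶ B' i) :
    ∀ (n : ℕ) (W : Fin n → FreeMonoidalCategory ι),
    (projectFinTensor B n W).hom ≫ finTensorMap (fun i => wordMap g (W i)) =
      wordMap g (finTensor n W) ≫ (projectFinTensor B' n W).hom
  | 0, _ => rfl
  | n + 1, W => by
    have ih := wordMap_finTensor g n (fun i => W i.succ)
    change _ ◁ (projectFinTensor B n fun i => W i.succ).hom ≫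
      (wordMap g (W 0) ⊗ₘ finTensorMap fun i : Fin n => wordMap g (W i.succ)) =
      (wordMap g (W 0) ⊗ₘ wordMap g (finTensor n fun i => W i.succ)) ≫
        _ ◁ (projectFinTensor B' n fun i => W i.succ).hom
    rw [whiskerLeft_comp_tensorHom, tensorHom_comp_whiskerLeft, ih]

lemma comp_square_aux {C : Type*} [Category* C] {X₀ X₁ X₂ X₃ X₄ Y₀ Y₁ Y₂ Y₃ Y₄ : C}
    {i : X₀ ⟶ X₁} {p : X₁ ⟶ X₂} {q : X₂ ⟶ X₃} {r : X₃ ⟶ X₄}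
    {i' : Y₀ ⟶ Y₁} {p' : Y₁ ⟶ Y₂} {q' : Y₂ ⟶ Y₃} {r' : Y₃ ⟶ Y₄}
    {f₀ : X₀ ⟶ Y₀} {f₁ : X₁ ⟶ Y₁} {f₂ : X₂ ⟶ Y₂} {f₃ : X₃ ⟶ Y₃} {f₄ : X₄ ⟶ Y₄}
    (h₁ : f₀ ≫ i' = i ≫ f₁) (h₂ : p ≫ f₂ = f₁ ≫ p') (h₃ : q ≫ f₃ = f₂ ≫ q')
    (h₄ : r ≫ f₄ = f₃ ≫ r') :
    f₀ ≫ i' ≫ p' ≫ q' ≫ r' = (i ≫ p ≫ q ≫ r) ≫ f₄ := by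
  simp only [Category.assoc, h₄, reassoc_of% h₃, reassoc_of% h₂, reassoc_of% h₁]

lemma inv_square_aux {C : Type*} [Category* C] {X X' Y Y' : C} {i : X ≅ X'} {j : Y ≅ Y'}
    {f : X' ⟶ Y'} {g : X ⟶ Y} (h : i.hom ≫ f = g ≫ j.hom) : f ≫ j.inv = i.inv ≫ g := by
  rw [Iso.eq_inv_comp, ← Category.assoc, Iso.comp_inv_eq, h]

lemma map_comp_aux {C D : Type*} [Category* C] [Category* D] (G : C ⥤ D) {X₀ X₁ X₂ X₃ X₄ : C}
    (i : X₀ ⟶ X₁) (p : X₁ ⟶ X₂) (q : X₂ ⟶ X₃) (r : X₃ ⟶ X₄) :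
    G.map i ≫ G.map p ≫ G.map q ≫ G.map r = G.map (i ≫ p ≫ q ≫ r) := by
  simp

lemma endComp_one_aux {C : Type*} [Category* C] {X Y Z V T : C} {a : X ⟶ Y} {b : Y ⟶ Z}
    {c : Z ⟶ X} {d : Z ⟶ V} {e : V ⟶ T} {f : X ⟶ T} (h₁ : a ≫ b ≫ c = 𝟙 X)
    (h₂ : d ≫ e = c ≫ f) : a ≫ b ≫ d ≫ e = f := by
  rw [h₂, reassoc_of% h₁]

lemma endComp_assoc_aux {C : Type*} [Category* C] {X₀ X₁ X₂ X₃ X₄ X₅ X₆ X₇ X₈ : C}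
    {a : X₀ ⟶ X₁} {b : X₁ ⟶ X₂} {c : X₂ ⟶ X₃} {d : X₀ ⟶ X₄} {e : X₄ ⟶ X₃}
    {f : X₂ ⟶ X₅} {g : X₅ ⟶ X₆} {h : X₃ ⟶ X₆} {i : X₆ ⟶ X₇} {j : X₇ ⟶ X₈}
    (h₁ : a ≫ b ≫ c = d ≫ e) (h₂ : f ≫ g = c ≫ h) :
    a ≫ b ≫ f ≫ g ≫ i ≫ j = d ≫ e ≫ h ≫ i ≫ j := by
  rw [reassoc_of% h₂, ← reassoc_of% h₁]

/-- `regroup` is natural. -/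
lemma regroup_naturality {n : ℕ} (m : Fin n → ℕ) {B B' : (Σ i, Fin (m i)) → E}
    (g : ∀ s, B s ⟶ B' s) :
    finTensorMap (fun l => g (finSigmaFinEquiv.symm l)) ≫ regroup m B' =
      regroup m B ≫ finTensorMap (fun i => finTensorMap (fun j => g ⟨i, j⟩)) := by
  have h1 := wordMap_finTensor g (∑ i, m i) (fun l => .of (finSigmaFinEquiv.symm l))
  have h2 := wordMap_finTensor g n (fun i => finTensor (m i) (fun j => .of ⟨i, j⟩))
  have h3 := fun i => wordMap_finTensor g (m i) (fun j => .of ⟨i, j⟩)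
  have h3' := congrArg finTensorMap (funext h3)
  rw [finTensorMap_comp, finTensorMap_comp] at h3'
  refine comp_square_aux ?_ (wordMap_naturality g (flatToNested m)) h2 h3'
  exact inv_square_aux h1

/-- Substituting words for letters. -/
def substMap {ι κ : Type} {A : κ → E} {W : ι → FreeMonoidalCategory κ} {B : ι → E}
    (r : ∀ s, (project A).obj (W s) ⟶ B s) : (X : FreeMonoidalCategory ι) →
    ((project A).obj ((project W).obj X) ⟶ (project B).obj X)
  | .of i => r i
  | .unit => 𝟙 (𝟙_ E)
  | .tensor X Y => substMap r X ⊗ₘ substMap r Y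

lemma substMap_naturality {ι κ : Type} {A : κ → E} {W : ι → FreeMonoidalCategory κ} {B : ι → E}
    (r : ∀ s, (project A).obj (W s) ⟶ B s) {X Y : FreeMonoidalCategory ι} (f : X ⟶ Y) :
    (project A).map ((project W).map f) ≫ substMap r Y = substMap r X ≫ (project B).map f := by
  induction f using FreeMonoidalCategory.Hom.inductionOn with
  | id X => simp
  | α_hom X Y Z => exact (associator_naturality _ _ _).symm
  | α_inv X Y Z => exact (associator_inv_naturality _ _ _).symm
  | l_hom X =>
    change (λ_ _).hom ≫ substMap r X = (𝟙 (𝟙_ E) ⊗ₘ substMap r X) ≫ (λ_ _).hom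
    simp
  | l_inv X =>
    refine Eq.trans (b := (λ_ _).inv ≫ (𝟙 (𝟙_ E) ⊗ₘ substMap r X)) rfl ?_
    rw [id_tensorHom]
    exact (leftUnitor_inv_naturality _).symm
  | ρ_hom X =>
    change (ρ_ _).hom ≫ substMap r X = (substMap r X ⊗ₘ 𝟙 (𝟙_ E)) ≫ (ρ_ _).hom
    simp
  | ρ_inv X =>
    refine Eq.trans (b := (ρ_ _).inv ≫ (substMap r X ⊗ₘ 𝟙 (𝟙_ E))) rfl ?_
    rw [tensorHom_id]
    exact (rightUnitor_inv_naturality _).symm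
  | comp f h hf hh =>
    rw [Functor.map_comp, Functor.map_comp, Functor.map_comp, Category.assoc, hh,
      reassoc_of% hf]
  | @whiskerLeft X Y Z f hf =>
    have h : (project A).map ((project W).map (X ◁ f)) =
        (project A).obj ((project W).obj X) ◁ (project A).map ((project W).map f) :=
      (congrArg (project A).map (project_map_whiskerLeft W X f)).trans
        (project_map_whiskerLeft A _ _)
    rw [h, project_map_whiskerLeft]
    refine (whiskerLeft_comp_tensorHom (substMap r X) ((project A).map ((project W).map f))
      (substMap r Z)).trans (Eq.trans ?_ (tensorHom_comp_whiskerLeft (substMap r X)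
      (substMap r Y) ((project B).map f)).symm)
    rw [hf]
  | @whiskerRight Y Z f X hf =>
    have h : (project A).map ((project W).map (f ▷ X)) =
        (project A).map ((project W).map f) ▷ (project A).obj ((project W).obj X) :=
      (congrArg (project A).map (project_map_whiskerRight W X f)).trans
        (project_map_whiskerRight A _ _)
    rw [h, project_map_whiskerRight]
    refine (whiskerRight_comp_tensorHom ((project A).map ((project W).map f))
      (substMap r Z) (substMap r X)).trans (Eq.trans ?_ (tensorHom_comp_whiskerRight
      (substMap r Y) ((project B).map f) (substMap r X)).symm)
    rw [hf]

/-- Presentations of a family of objects by words give a presentation of their tensor product. -/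
def presTensor {κ : Type} (A : κ → E) : {n : ℕ} → {W : Fin n → FreeMonoidalCategory κ} →
    {B : Fin n → E} → (∀ i, (project A).obj (W i) ⟶ B i) →
    ((project A).obj (finTensor n W) ⟶ finTensor n B)
  | 0, _, _, _ => 𝟙 (𝟙_ E)
  | _ + 1, _, _, r => r 0 ⊗ₘ presTensor A (fun i => r i.succ)

lemma presTensor_comp {κ : Type} (A : κ → E) : ∀ {n : ℕ} {W : Fin n → FreeMonoidalCategory κ}
    {B B' : Fin n → E} (r : ∀ i, (project A).obj (W i) ⟶ B i) (g : ∀ i, B i ⟶ B' i),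
    presTensor A r ≫ finTensorMap g = presTensor A (fun i => r i ≫ g i)
  | 0, _, _, _, _, _ => Category.comp_id _
  | n + 1, _, _, _, r, g => by
    change (r 0 ⊗ₘ presTensor A (fun i : Fin n => r i.succ)) ≫
      (g 0 ⊗ₘ finTensorMap (fun i : Fin n => g i.succ)) = _
    rw [tensorHom_comp_tensorHom, presTensor_comp]
    rfl

lemma finTensorMap_presTensor {κ : Type} (A : κ → E) : ∀ {n : ℕ}
    {W W' : Fin n → FreeMonoidalCategory κ}
    {B : Fin n → E} (c : ∀ i, W i ⟶ W' i) (r : ∀ i, (project A).obj (W' i) ⟶ B i),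
    (project A).map (finTensorMap c) ≫ presTensor A r =
      presTensor A (fun i => (project A).map (c i) ≫ r i)
  | 0, _, _, _, _, _ => Category.id_comp (𝟙 (𝟙_ E))
  | n + 1, W, W', B, c, r => by
    refine (congrArg (· ≫ _) (project_map_tensorHom A (c 0)
      (finTensorMap (fun i : Fin n => c i.succ)))).trans ?_
    refine (tensorHom_comp_tensorHom _ _ _ _).trans ?_
    rw [finTensorMap_presTensor A (fun i : Fin n => c i.succ) (fun i : Fin n => r i.succ)]
    rfl

lemma substMap_finTensor {ι κ : Type} {A : κ → E} {W : ι → FreeMonoidalCategory κ} {B : ι → E}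
    (r : ∀ s, (project A).obj (W s) ⟶ B s) :
    ∀ (n : ℕ) (V : Fin n → FreeMonoidalCategory ι),
    (project A).map (projectFinTensor W n V).hom ≫ presTensor A (fun i => substMap r (V i)) =
      substMap r (finTensor n V) ≫ (projectFinTensor B n V).hom
  | 0, _ => rfl
  | n + 1, V => by
    have ih := substMap_finTensor r n (fun i => V i.succ)
    refine (congrArg (· ≫ _) (project_map_whiskerLeft A ((project W).obj (V 0))
      (projectFinTensor W n fun i => V i.succ).hom)).trans ?_
    refine (whiskerLeft_comp_tensorHom (substMap r (V 0))
      ((project A).map (projectFinTensor W n fun i => V i.succ).hom)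
      (presTensor A fun i : Fin n => substMap r (V i.succ))).trans (Eq.trans ?_
      (tensorHom_comp_whiskerLeft (substMap r (V 0)) (substMap r (finTensor n fun i => V i.succ))
        (projectFinTensor B n fun i => V i.succ).hom).symm)
    rw [ih]

/-- `regroup` comes from a morphism of words. -/
lemma exists_regroup {κ : Type} (A : κ → E) {n : ℕ} (m : Fin n → ℕ)
    {B : (Σ i, Fin (m i)) → E} {W : (Σ i, Fin (m i)) → FreeMonoidalCategory κ}
    (r : ∀ s, (project A).obj (W s) ⟶ B s) :
    ∃ c, presTensor A (fun l => r (finSigmaFinEquiv.symm l)) ≫ regroup m B =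
      (project A).map c ≫ presTensor A (fun i => presTensor A (fun j => r ⟨i, j⟩)) := by
  refine ⟨regroup m W, ?_⟩
  have h1 := substMap_finTensor r (∑ i, m i) (fun l => .of (finSigmaFinEquiv.symm l))
  have h2 := substMap_finTensor r n (fun i => finTensor (m i) (fun j => .of ⟨i, j⟩))
  have h3 := fun i => substMap_finTensor r (m i) (fun j => .of ⟨i, j⟩)
  have h3' := (finTensorMap_presTensor A
    (fun i => (projectFinTensor W (m i) (fun j => .of ⟨i, j⟩)).hom)
    (fun i => presTensor A (fun j => r ⟨i, j⟩))).trans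
      ((congrArg (presTensor A) (funext h3)).trans (presTensor_comp A _ _).symm)
  refine (comp_square_aux (i := (project A).map (projectFinTensor W (∑ i, m i)
      (fun l => .of (finSigmaFinEquiv.symm l))).inv)
    ?_ (substMap_naturality r (flatToNested m)) h2 h3').trans ?_
  · exact inv_square_aux (i := (project A).mapIso (projectFinTensor W (∑ i, m i)
      (fun l => .of (finSigmaFinEquiv.symm l)))) h1
  · exact congrArg (· ≫ _) (map_comp_aux (project A) _ _ _ _)

/-- A morphism between objects presented by words is structural if it comes from the (unique)
morphism between these words. -/
def IsStructural (A : E) {X X' : FreeMonoidalCategory Unit} {Y Y' : E}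
    (r : (project fun _ => A).obj X ⟶ Y) (r' : (project fun _ => A).obj X' ⟶ Y')
    (f : Y ⟶ Y') : Prop :=
  ∃ c, r ≫ f = (project fun _ => A).map c ≫ r'

lemma IsStructural.unique {A : E} {X X' : FreeMonoidalCategory Unit} {Y Y' : E}
    {r : (project fun _ => A).obj X ⟶ Y} {r' : (project fun _ => A).obj X' ⟶ Y'}
    {f g : Y ⟶ Y'} (hf : IsStructural A r r' f) (hg : IsStructural A r r' g) [IsIso r] :
    f = g := by
  obtain ⟨c, hc⟩ := hf
  obtain ⟨d, hd⟩ := hg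
  rw [← cancel_epi r, hc, hd, Subsingleton.elim c d]

lemma IsStructural.id {A : E} {X : FreeMonoidalCategory Unit} {Y : E}
    (r : (project fun _ => A).obj X ⟶ Y) : IsStructural A r r (𝟙 Y) :=
  ⟨𝟙 X, by simp⟩

lemma IsStructural.comp {A : E} {X X' X'' : FreeMonoidalCategory Unit} {Y Y' Y'' : E}
    {r : (project fun _ => A).obj X ⟶ Y} {r' : (project fun _ => A).obj X' ⟶ Y'}
    {r'' : (project fun _ => A).obj X'' ⟶ Y''}
    {f : Y ⟶ Y'} {g : Y' ⟶ Y''} (hf : IsStructural A r r' f) (hg : IsStructural A r' r'' g) :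
    IsStructural A r r'' (f ≫ g) := by
  obtain ⟨c, hc⟩ := hf
  obtain ⟨d, hd⟩ := hg
  exact ⟨c ≫ d, by rw [Functor.map_comp, reassoc_of% hc, hd, Category.assoc]⟩

lemma IsStructural.finTensorMap {A : E} {n : ℕ} {W W' : Fin n → FreeMonoidalCategory Unit}
    {B B' : Fin n → E} {r : ∀ i, (project fun _ => A).obj (W i) ⟶ B i}
    {r' : ∀ i, (project fun _ => A).obj (W' i) ⟶ B' i} {f : ∀ i, B i ⟶ B' i}
    (hf : ∀ i, IsStructural A (r i) (r' i) (f i)) :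
    IsStructural A (presTensor _ r) (presTensor _ r') (finTensorMap f) := by
  choose c hc using hf
  refine ⟨TwistOperad.finTensorMap c, ?_⟩
  rw [presTensor_comp, funext hc, finTensorMap_presTensor]

instance isIso_presTensor {κ : Type} (A : κ → E) : ∀ {n : ℕ}
    {W : Fin n → FreeMonoidalCategory κ} {B : Fin n → E}
    (r : ∀ i, (project A).obj (W i) ⟶ B i) [∀ i, IsIso (r i)], IsIso (presTensor A r)
  | 0, _, _, _, _ => inferInstanceAs (IsIso (𝟙 (𝟙_ E)))
  | n + 1, _, _, r, _ => by
    have := isIso_presTensor A (fun i : Fin n => r i.succ)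
    exact inferInstanceAs (IsIso (r 0 ⊗ₘ presTensor A (fun i => r i.succ)))

/-- The presentation of a tensor power by a word. -/
def presPow (A : E) (n : ℕ) :
    (project fun _ => A).obj (finTensor n fun _ => FreeMonoidalCategory.of ()) ⟶ tensorPow A n :=
  presTensor _ (fun _ => 𝟙 A)

instance (A : E) (n : ℕ) : IsIso (presPow A n) := by
  unfold presPow
  have : IsIso (𝟙 ((project fun _ : Unit => A).obj (.of ()))) := inferInstance
  exact isIso_presTensor (fun _ : Unit => A) (W := fun _ : Fin n => .of ())
    (fun _ => 𝟙 ((project fun _ : Unit => A).obj (.of ())))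

lemma isStructural_regroup (A : E) {n : ℕ} (m : Fin n → ℕ)
    {B : (Σ i, Fin (m i)) → E} {W : (Σ i, Fin (m i)) → FreeMonoidalCategory Unit}
    (r : ∀ s, (project fun _ => A).obj (W s) ⟶ B s) :
    IsStructural A (presTensor _ (fun l => r (finSigmaFinEquiv.symm l)))
      (presTensor _ (fun i => presTensor _ (fun j => r ⟨i, j⟩))) (regroup m B) :=
  exists_regroup _ m r

/-- Tensor powers with equal exponents are identified. -/
def powCast (A : E) {a b : ℕ} (h : a = b) : tensorPow A a ⟶ tensorPow A b :=
  eqToHom (by rw [h])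

lemma isStructural_powCast (A : E) {a b : ℕ} (h : a = b) :
    IsStructural A (presPow A a) (presPow A b) (powCast A h) := by
  subst h
  exact IsStructural.id _

lemma isStructural_rightUnitor {A : E} {X : FreeMonoidalCategory Unit} {Y : E}
    (r : (project fun _ => A).obj X ⟶ Y) :
    IsStructural A (X := X ⊗ 𝟙_ _) (r ⊗ₘ 𝟙 (𝟙_ E)) r (ρ_ Y).hom := by
  refine ⟨(ρ_ X).hom, ?_⟩
  have h := rightUnitor_naturality r
  rw [← tensorHom_id] at h
  exact h

/-- Composition in the endomorphism operad of an object: `f ∘ (g 0 ⊗ ⋯ ⊗ g (n - 1))`, where the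
source `A^{⊗ (∑ i, m i)}` is rebracketed as `⊗_i A^{⊗ (m i)}`. -/
noncomputable def endComp {A : E} {n : ℕ} (m : Fin n → ℕ) (f : tensorPow A n ⟶ A)
    (g : ∀ i, tensorPow A (m i) ⟶ A) : tensorPow A (∑ i, m i) ⟶ A :=
  regroup m (fun _ => A) ≫ finTensorMap g ≫ f

lemma endComp_one_left {A : E} {n : ℕ} (g : tensorPow A n ⟶ A) (h : n = ∑ _i : Fin 1, n) :
    powCast A h ≫ endComp (fun _ : Fin 1 => n) (ρ_ A).hom (fun _ => g) = g := by
  have key : powCast A h ≫ regroup (fun _ : Fin 1 => n) (fun _ => A) ≫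
      (ρ_ (tensorPow A n)).hom = 𝟙 _ :=
    ((isStructural_powCast A h).comp ((isStructural_regroup A (fun _ : Fin 1 => n)
      (W := fun _ => .of ()) (fun _ => 𝟙 A)).comp (isStructural_rightUnitor (presPow A n)))).unique
      (IsStructural.id (presPow A n))
  have h2 : finTensorMap (fun _ : Fin 1 => g) ≫ (ρ_ A).hom = (ρ_ (tensorPow A n)).hom ≫ g := by
    change (g ⊗ₘ 𝟙 (𝟙_ E)) ≫ (ρ_ A).hom = _
    simp
  exact endComp_one_aux key h2

lemma endComp_one_right {A : E} {n : ℕ} (f : tensorPow A n ⟶ A) (h : n = ∑ _i : Fin n, 1) :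
    powCast A h ≫ endComp (fun _ : Fin n => 1) f (fun _ => (ρ_ A).hom) = f := by
  have key : powCast A h ≫ regroup (fun _ : Fin n => 1) (fun _ => A) ≫
      finTensorMap (fun _ => (ρ_ A).hom) = 𝟙 _ := by
    refine ((isStructural_powCast A h).comp ((isStructural_regroup A (fun _ : Fin n => 1)
      (W := fun _ => .of ()) (fun _ => 𝟙 A)).comp
      (IsStructural.finTensorMap (W' := fun _ => .of ())
        (r' := fun _ => 𝟙 ((project fun _ : Unit => A).obj (.of ()))) (fun _ => ?_)))).unique
      (IsStructural.id (presPow A n))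
    exact isStructural_rightUnitor (X := .of ()) (𝟙 A)
  exact endComp_one_aux key rfl

lemma endComp_assoc {A : E} {n : ℕ} (m : Fin n → ℕ) (p : ∀ i, Fin (m i) → ℕ)
    (x : tensorPow A n ⟶ A) (y : ∀ i, tensorPow A (m i) ⟶ A)
    (z : ∀ i j, tensorPow A (p i j) ⟶ A)
    (h : ∑ i, ∑ j, p i j =
      ∑ l, p (finSigmaFinEquiv.symm l).1 (finSigmaFinEquiv.symm l).2) :
    powCast A h ≫ endComp (fun l => p (finSigmaFinEquiv.symm l).1 (finSigmaFinEquiv.symm l).2)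
      (endComp m x y) (fun l => z (finSigmaFinEquiv.symm l).1 (finSigmaFinEquiv.symm l).2) =
    endComp (fun i => ∑ j, p i j) x (fun i => endComp (p i) (y i) (z i)) := by
  have key : powCast A h ≫
      regroup (fun l => p (finSigmaFinEquiv.symm l).1 (finSigmaFinEquiv.symm l).2) (fun _ => A) ≫
      regroup m (fun s => tensorPow A (p s.1 s.2)) =
      regroup (fun i => ∑ j, p i j) (fun _ => A) ≫
        finTensorMap (fun i => regroup (p i) (fun _ => A)) := by
    refine IsStructural.unique (r := presPow A _) (r' := presTensor _ (fun i => presTensor _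
      (fun j => presPow A (p i j)))) ?_ ?_
    · exact (isStructural_powCast A h).comp ((isStructural_regroup A
        (fun l => p (finSigmaFinEquiv.symm l).1 (finSigmaFinEquiv.symm l).2)
        (W := fun _ => .of ()) (fun _ => 𝟙 A)).comp
        (isStructural_regroup A m (fun s => presPow A (p s.1 s.2))))
    · exact (isStructural_regroup A (fun i => ∑ j, p i j) (W := fun _ => .of ())
        (fun _ => 𝟙 A)).comp (IsStructural.finTensorMap fun i =>
          isStructural_regroup A (p i) (W := fun _ => .of ()) (fun _ => 𝟙 A))
  have nat := regroup_naturality m (B := fun s => tensorPow A (p s.1 s.2)) (B' := fun _ => A)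
    (fun s => z s.1 s.2)
  unfold endComp
  rw [finTensorMap_comp, finTensorMap_comp]
  simp only [Category.assoc]
  exact endComp_assoc_aux key nat

end Coherence
end Tensor

section Operad

/-- A (nonsymmetric) operad of simplicial sets. The composition law
`space n × ∏ i, space (m i) ⟶ space (∑ i, m i)` is given on `k`-simplices by `comp m`, and it is
a simplicial map by `map_comp`. -/
structure SimplicialOperad where
  /-- the space of operations of arity `n` -/
  space : ℕ → SSet.{w}
  /-- the unit, in each simplicial degree -/
  one (k : SimplexCategoryᵒᵖ) : (space 1).obj k
  /-- the composition law -/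
  comp {k : SimplexCategoryᵒᵖ} {n : ℕ} (m : Fin n → ℕ) (x : (space n).obj k)
    (y : ∀ i, (space (m i)).obj k) : (space (∑ i, m i)).obj k
  map_one {k l : SimplexCategoryᵒᵖ} (θ : k ⟶ l) : (space 1).map θ (one k) = one l
  map_comp {k l : SimplexCategoryᵒᵖ} (θ : k ⟶ l) {n : ℕ} (m : Fin n → ℕ) (x : (space n).obj k)
    (y : ∀ i, (space (m i)).obj k) :
    (space (∑ i, m i)).map θ (comp m x y) =
      comp m ((space n).map θ x) (fun i => (space (m i)).map θ (y i))
  one_comp {k : SimplexCategoryᵒᵖ} {n : ℕ} (x : (space n).obj k) (h : ∑ _i : Fin 1, n = n) :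
    (eqToHom (congrArg space h)).app k (comp (fun _ : Fin 1 => n) (one k) (fun _ => x)) = x
  comp_one {k : SimplexCategoryᵒᵖ} {n : ℕ} (x : (space n).obj k) (h : ∑ _i : Fin n, 1 = n) :
    (eqToHom (congrArg space h)).app k (comp (fun _ : Fin n => 1) x (fun _ => one k)) = x
  comp_assoc {k : SimplexCategoryᵒᵖ} {n : ℕ} (m : Fin n → ℕ) (p : ∀ i, Fin (m i) → ℕ)
    (x : (space n).obj k) (y : ∀ i, (space (m i)).obj k) (z : ∀ i j, (space (p i j)).obj k)
    (h : ∑ l, p (finSigmaFinEquiv.symm l).1 (finSigmaFinEquiv.symm l).2 =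
      ∑ i, ∑ j, p i j) :
    (eqToHom (congrArg space h)).app k
      (comp (fun l => p (finSigmaFinEquiv.symm l).1 (finSigmaFinEquiv.symm l).2) (comp m x y)
        (fun l => z (finSigmaFinEquiv.symm l).1 (finSigmaFinEquiv.symm l).2)) =
      comp (fun i => ∑ j, p i j) x (fun i => comp (p i) (y i) (z i))

/-- A morphism of operads of simplicial sets (possibly living in different universes): simplicial
maps in each arity, compatible with the units and the composition laws. -/
structure SimplicialOperad.Hom (O : SimplicialOperad.{w}) (P : SimplicialOperad.{w'}) where
  /-- the underlying maps -/
  app (n : ℕ) (k : SimplexCategoryᵒᵖ) : (O.space n).obj k → (P.space n).obj k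
  naturality (n : ℕ) {k l : SimplexCategoryᵒᵖ} (θ : k ⟶ l) (x : (O.space n).obj k) :
    app n l ((O.space n).map θ x) = (P.space n).map θ (app n k x)
  map_one (k : SimplexCategoryᵒᵖ) : app 1 k (O.one k) = P.one k
  map_comp {k : SimplexCategoryᵒᵖ} {n : ℕ} (m : Fin n → ℕ) (x : (O.space n).obj k)
    (y : ∀ i, (O.space (m i)).obj k) :
    app _ k (O.comp m x y) = P.comp m (app n k x) (fun i => app (m i) k (y i))

/-- An `A_∞`-operad: each space is contractible. (The geometric realization of a simplicial set is
a CW complex, so being contractible and being weakly contractible are the same.) -/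
def SimplicialOperad.IsAInfinity (O : SimplicialOperad.{w}) : Prop :=
  ∀ n, ContractibleSpace (SSet.toTop.obj (O.space n))

end Operad

section MappingSpace

variable {E : Type u} [Category.{v} E]

/-- The cotensor `[S, X]` of the external simplicial structure: in cosimplicial degree `j` it is
the product of copies of `X^j` indexed by the `j`-simplices of `S`. -/
noncomputable def cotensor [HasLimitsOfSize.{0, 0} E] (S : SSet.{0}) (X : SimplexCategory ⥤ E) :
    SimplexCategory ⥤ E where
  obj j := ∏ᶜ fun _ : S.obj (op j) => X.obj j
  map {j j'} f := Pi.lift fun s : S.obj (op j') =>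
    Pi.π (fun _ : S.obj (op j) => X.obj j) (S.map f.op s) ≫ X.map f
  map_id j := by
    apply Pi.hom_ext
    intro s
    simp
  map_comp {j j' j''} f g := by
    apply Pi.hom_ext
    intro s
    simp

lemma cotensor_naturality [HasLimitsOfSize.{0, 0} E] {S : SSet.{0}} {X Y : SimplexCategory ⥤ E}
    (φ : X ⟶ cotensor S Y) {j j' : SimplexCategory} (f : j ⟶ j') (s : S.obj (op j')) :
    X.map f ≫ φ.app j' ≫ Pi.π (fun _ : S.obj (op j') => Y.obj j') s =
      (φ.app j ≫ Pi.π (fun _ : S.obj (op j) => Y.obj j) (S.map f.op s)) ≫ Y.map f := by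
  have h : (cotensor S Y).map f ≫ Pi.π (fun _ : S.obj (op j') => Y.obj j') s =
      Pi.π (fun _ : S.obj (op j) => Y.obj j) (S.map f.op s) ≫ Y.map f :=
    Limits.Pi.lift_π _ _
  refine (Category.assoc (X.map f) (φ.app j') _).symm.trans ?_
  refine (congrArg (· ≫ Pi.π (fun _ : S.obj (op j') => Y.obj j') s) (φ.naturality f)).trans ?_
  refine (Category.assoc (φ.app j) ((cotensor S Y).map f) _).trans ?_
  refine (congrArg (φ.app j ≫ ·) h).trans ?_
  exact (Category.assoc (φ.app j) _ _).symm

/-- The cotensor is contravariant in the simplicial set. -/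
noncomputable def cotensorMap [HasLimitsOfSize.{0, 0} E] {S T : SSet.{0}} (a : S ⟶ T)
    (X : SimplexCategory ⥤ E) : cotensor T X ⟶ cotensor S X where
  app j := Pi.lift fun s : S.obj (op j) => Pi.π (fun _ : T.obj (op j) => X.obj j) (a.app _ s)
  naturality j j' f := by
    apply Pi.hom_ext
    intro s
    simp [cotensor]

/-- The functor `k ↦ Δ[k]`. -/
def simplexFunctor : SimplexCategory ⥤ SSet.{0} := SSet.stdSimplex

lemma cotensorMap_stdSimplex_id [HasLimitsOfSize.{0, 0} E] (k : SimplexCategory)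
    (Y : SimplexCategory ⥤ E) :
    cotensorMap (simplexFunctor.map (𝟙 k)) Y = 𝟙 (cotensor (simplexFunctor.obj k) Y) := by
  rw [CategoryTheory.Functor.map_id]
  ext j
  apply Pi.hom_ext
  intro s
  simp [cotensorMap, cotensor]

lemma cotensorMap_stdSimplex_comp [HasLimitsOfSize.{0, 0} E] {k l l' : SimplexCategory}
    (a : k ⟶ l) (b : l ⟶ l') (Y : SimplexCategory ⥤ E) :
    cotensorMap (simplexFunctor.map (a ≫ b)) Y =
      cotensorMap (simplexFunctor.map b) Y ≫ cotensorMap (simplexFunctor.map a) Y := by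
  rw [CategoryTheory.Functor.map_comp]
  ext j
  apply Pi.hom_ext
  intro s
  simp [cotensorMap, cotensor]

/-- The mapping space of the external simplicial structure: its `k`-simplices are the cosimplicial
maps `X ⟶ [Δ[k], Y]`. -/
noncomputable def mapSpace [HasLimitsOfSize.{0, 0} E] (X Y : SimplexCategory ⥤ E) :
    SSet.{v} where
  obj k := X ⟶ cotensor (simplexFunctor.obj k.unop) Y
  map θ := ↾fun φ => φ ≫ cotensorMap (simplexFunctor.map θ.unop) Y
  map_id k := by
    apply ConcreteCategory.hom_ext
    intro φ
    exact (congrArg (φ ≫ ·) (cotensorMap_stdSimplex_id k.unop Y)).trans (Category.comp_id φ)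
  map_comp {k l l'} θ θ' := by
    apply ConcreteCategory.hom_ext
    intro φ
    exact (congrArg (φ ≫ ·) (cotensorMap_stdSimplex_comp θ'.unop θ.unop Y)).trans
      (Category.assoc φ _ _).symm

namespace mapSpace

variable [HasLimitsOfSize.{0, 0} E] {X Y : SimplexCategory ⥤ E} {k l : SimplexCategoryᵒᵖ}

/-- The component `X^j ⟶ Y^j` of a `k`-simplex of the mapping space at a `j`-simplex of
`Δ[k]`. -/
noncomputable def component (φ : (mapSpace X Y).obj k) (j : SimplexCategory)
    (s : (simplexFunctor.obj k.unop).obj (op j)) : X.obj j ⟶ Y.obj j :=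
  NatTrans.app (F := X) (G := cotensor (simplexFunctor.obj k.unop) Y) φ j ≫
    Pi.π (fun _ : (simplexFunctor.obj k.unop).obj (op j) => Y.obj j) s

lemma component_naturality (φ : (mapSpace X Y).obj k) {j j' : SimplexCategory} (f : j ⟶ j')
    (s : (simplexFunctor.obj k.unop).obj (op j')) :
    X.map f ≫ component φ j' s =
      component φ j ((simplexFunctor.obj k.unop).map f.op s) ≫ Y.map f :=
  cotensor_naturality (S := simplexFunctor.obj k.unop) φ f s

@[ext]
lemma ext {φ ψ : (mapSpace X Y).obj k} (h : ∀ j s, component φ j s = component ψ j s) :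
    φ = ψ := by
  apply NatTrans.ext
  funext j
  apply Pi.hom_ext
  exact h j

/-- A `k`-simplex of the mapping space is determined by a compatible family of components. -/
noncomputable def mk (c : ∀ (j : SimplexCategory)
    (_ : (simplexFunctor.obj k.unop).obj (op j)), X.obj j ⟶ Y.obj j)
    (hc : ∀ {j j' : SimplexCategory} (f : j ⟶ j')
      (s : (simplexFunctor.obj k.unop).obj (op j')),
      X.map f ≫ c j' s = c j ((simplexFunctor.obj k.unop).map f.op s) ≫ Y.map f) :
    (mapSpace X Y).obj k :=
  show X ⟶ cotensor (simplexFunctor.obj k.unop) Y from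
  { app j := Pi.lift (fun s => c j s)
    naturality j j' f := by
      apply Pi.hom_ext
      intro s
      simp [cotensor, hc] }

@[simp]
lemma component_mk (c : ∀ (j : SimplexCategory)
    (_ : (simplexFunctor.obj k.unop).obj (op j)), X.obj j ⟶ Y.obj j)
    (hc : ∀ {j j' : SimplexCategory} (f : j ⟶ j')
      (s : (simplexFunctor.obj k.unop).obj (op j')),
      X.map f ≫ c j' s = c j ((simplexFunctor.obj k.unop).map f.op s) ≫ Y.map f)
    (j : SimplexCategory) (s : (simplexFunctor.obj k.unop).obj (op j)) :
    component (mk c hc) j s = c j s := by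
  exact Limits.Pi.lift_π _ _

lemma component_map (φ : (mapSpace X Y).obj k) (θ : k ⟶ l) (j : SimplexCategory)
    (s : (simplexFunctor.obj l.unop).obj (op j)) :
    component ((mapSpace X Y).map θ φ) j s =
      component φ j ((simplexFunctor.map θ.unop).app _ s) := by
  refine (Category.assoc (NatTrans.app (F := X) (G := cotensor (simplexFunctor.obj k.unop) Y) φ j)
    ((cotensorMap (simplexFunctor.map θ.unop) Y).app j) _).trans ?_
  exact congrArg (_ ≫ ·) (Limits.Pi.lift_π _ _)

end mapSpace

end MappingSpace

section EndomorphismOperad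

variable {E : Type u} [Category.{v} E] [MonoidalCategory E]

lemma endComp_naturality_aux {C : Type*} [Category* C] {X Y Z V T U : C} {a : X ⟶ Y}
    {b : Y ⟶ Z} {c : X ⟶ V} {d : V ⟶ Z} {e : Z ⟶ T} {f : T ⟶ U} (h : a ≫ b = c ≫ d) :
    a ≫ b ≫ e ≫ f = c ≫ d ≫ e ≫ f := by
  rw [reassoc_of% h]

lemma endComp_naturality {A B : E} (a : A ⟶ B) {n : ℕ} (m : Fin n → ℕ)
    {f : tensorPow A n ⟶ A} {f' : tensorPow B n ⟶ B}
    {g : ∀ i, tensorPow A (m i) ⟶ A} {g' : ∀ i, tensorPow B (m i) ⟶ B}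
    (hf : finTensorMap (fun _ => a) ≫ f' = f ≫ a)
    (hg : ∀ i, finTensorMap (fun _ => a) ≫ g' i = g i ≫ a) :
    finTensorMap (fun _ => a) ≫ endComp m f' g' = endComp m f g ≫ a := by
  have h₁ := regroup_naturality m (B := fun _ => A) (B' := fun _ => B) (fun _ => a)
  have h₂ := congrArg finTensorMap (funext hg)
  rw [finTensorMap_comp, finTensorMap_comp] at h₂
  unfold endComp
  simp only [Category.assoc]
  rw [← hf, ← reassoc_of% h₂]
  exact endComp_naturality_aux h₁

/-- The `n`-th power of a cosimplicial object for the levelwise monoidal structure. -/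
def cosimplicialPow (X : SimplexCategory ⥤ E) (n : ℕ) : SimplexCategory ⥤ E where
  obj j := tensorPow (X.obj j) n
  map f := finTensorMap (fun _ => X.map f)
  map_id j := by
    rw [← finTensorMap_id]
    simp only [CategoryTheory.Functor.map_id]
  map_comp f g := by
    simp only [Functor.map_comp]
    exact finTensorMap_comp _ _

lemma endUnit_naturality (X : SimplexCategory ⥤ E) {j j' : SimplexCategory} (f : j ⟶ j') :
    (cosimplicialPow X 1).map f ≫ (ρ_ (X.obj j')).hom = (ρ_ (X.obj j)).hom ≫ X.map f := by
  have h := rightUnitor_naturality (X.map f)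
  rw [← tensorHom_id] at h
  exact h

variable [HasLimitsOfSize.{0, 0} E]

lemma component_arityCast (X : SimplexCategory ⥤ E) {k : SimplexCategoryᵒᵖ} {a b : ℕ}
    (h : a = b) (φ : (mapSpace (cosimplicialPow X a) X).obj k) (j : SimplexCategory)
    (s : (simplexFunctor.obj k.unop).obj (op j)) :
    mapSpace.component ((eqToHom (congrArg (fun n => mapSpace (cosimplicialPow X n) X) h)).app k φ)
      j s = powCast (X.obj j) h.symm ≫ mapSpace.component φ j s := by
  subst h
  exact (Category.id_comp _).symm

lemma endComposite_naturality (X : SimplexCategory ⥤ E) {k : SimplexCategoryᵒᵖ} {n : ℕ}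
    (m : Fin n → ℕ) (x : (mapSpace (cosimplicialPow X n) X).obj k)
    (y : ∀ i, (mapSpace (cosimplicialPow X (m i)) X).obj k) {j j' : SimplexCategory} (f : j ⟶ j')
    (s : (simplexFunctor.obj k.unop).obj (op j')) :
    (cosimplicialPow X (∑ i, m i)).map f ≫
        endComp m (mapSpace.component x j' s) (fun i => mapSpace.component (y i) j' s) =
      endComp m (mapSpace.component x j ((simplexFunctor.obj k.unop).map f.op s))
        (fun i => mapSpace.component (y i) j ((simplexFunctor.obj k.unop).map f.op s)) ≫
        X.map f :=
  endComp_naturality (X.map f) m (mapSpace.component_naturality x f s)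
    (fun i => mapSpace.component_naturality (y i) f s)

/-- The unit of the endomorphism operad: the identity of `X`, as a map `X ⊗ 𝟙_ ⟶ X`. -/
noncomputable def endUnit (X : SimplexCategory ⥤ E) (k : SimplexCategoryᵒᵖ) :
    (mapSpace (cosimplicialPow X 1) X).obj k :=
  mapSpace.mk (fun j _ => (ρ_ (X.obj j)).hom) (fun f _ => endUnit_naturality X f)

/-- The composite `x ∘ (y 0 ⊗ ⋯ ⊗ y (n - 1))` of `k`-simplices `x : X^{⊗ n} ⟶ [Δ[k], X]` and
`y i : X^{⊗ (m i)} ⟶ [Δ[k], X]` of mapping spaces. Composition and tensor product of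
`k`-simplices are formed separately for each component, i.e. for each simplex of `Δ[k]`. -/
noncomputable def endComposite (X : SimplexCategory ⥤ E) {k : SimplexCategoryᵒᵖ} {n : ℕ}
    (m : Fin n → ℕ) (x : (mapSpace (cosimplicialPow X n) X).obj k)
    (y : ∀ i, (mapSpace (cosimplicialPow X (m i)) X).obj k) :
    (mapSpace (cosimplicialPow X (∑ i, m i)) X).obj k :=
  mapSpace.mk
    (fun j s => endComp m (mapSpace.component x j s) (fun i => mapSpace.component (y i) j s))
    (endComposite_naturality X m x y)

lemma component_endUnit (X : SimplexCategory ⥤ E) (k : SimplexCategoryᵒᵖ) (j : SimplexCategory)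
    (s : (simplexFunctor.obj k.unop).obj (op j)) :
    mapSpace.component (endUnit X k) j s = (ρ_ (X.obj j)).hom :=
  mapSpace.component_mk _ (fun f _ => endUnit_naturality X f) j s

lemma component_endComposite (X : SimplexCategory ⥤ E) {k : SimplexCategoryᵒᵖ} {n : ℕ}
    (m : Fin n → ℕ) (x : (mapSpace (cosimplicialPow X n) X).obj k)
    (y : ∀ i, (mapSpace (cosimplicialPow X (m i)) X).obj k) (j : SimplexCategory)
    (s : (simplexFunctor.obj k.unop).obj (op j)) :
    mapSpace.component (endComposite X m x y) j s =
      endComp m (mapSpace.component x j s) (fun i => mapSpace.component (y i) j s) :=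
  mapSpace.component_mk _ (endComposite_naturality X m x y) j s

/-- The endomorphism operad of a cosimplicial object `X`: its `n`-th space is the mapping space
`map (X^{⊗ n}, X)`. -/
noncomputable def endOperad (X : SimplexCategory ⥤ E) : SimplicialOperad.{v} where
  space n := mapSpace (cosimplicialPow X n) X
  one k := endUnit X k
  comp m x y := endComposite X m x y
  map_one θ := by
    apply mapSpace.ext
    intro j s
    exact (mapSpace.component_map _ θ j s).trans
      ((component_endUnit X _ j _).trans (component_endUnit X _ j s).symm)
  map_comp θ n m x y := by
    apply mapSpace.ext
    intro j s
    refine (mapSpace.component_map _ θ j s).trans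
      ((component_endComposite X m x y j _).trans (Eq.trans ?_
        (component_endComposite X m _ _ j s).symm))
    simp only [mapSpace.component_map]
    rfl
  one_comp x h := by
    apply mapSpace.ext
    intro j s
    refine (component_arityCast X h _ j s).trans ?_
    rw [component_endComposite, component_endUnit]
    exact endComp_one_left _ h.symm
  comp_one x h := by
    apply mapSpace.ext
    intro j s
    refine (component_arityCast X h _ j s).trans ?_
    simp only [component_endComposite, component_endUnit]
    exact endComp_one_right _ h.symm
  comp_assoc m p x y z h := by
    apply mapSpace.ext
    intro j s
    refine (component_arityCast X h _ j s).trans ?_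
    simp only [component_endComposite]
    exact endComp_assoc m p _ _ (fun i j' => mapSpace.component (z i j') j s) h.symm

end EndomorphismOperad

section Cobar

variable {E : Type u} [Category.{v} E] [MonoidalCategory E]

section Coherence

variable {A : E}

lemma insertUnit_mulLeft_aux (e : 𝟙_ E ⟶ A) (m : A ⊗ A ⟶ A) (X : E) :
    ((λ_ (A ⊗ X)).inv ≫ e ▷ (A ⊗ X)) ≫ (α_ A A X).inv ≫ m ▷ X =
      ((λ_ A).inv ≫ e ▷ A ≫ m) ▷ X := by
  simp

lemma whiskerLeft_insertUnit_mulLeft_aux (e : 𝟙_ E ⟶ A) (m : A ⊗ A ⟶ A) (X : E) :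
    A ◁ ((λ_ X).inv ≫ e ▷ X) ≫ (α_ A A X).inv ≫ m ▷ X =
      ((ρ_ A).inv ≫ A ◁ e ≫ m) ▷ X := by
  simp

lemma mulLeft_mulLeft_aux (m : A ⊗ A ⟶ A) (X : E) :
    ((α_ A A (A ⊗ X)).inv ≫ m ▷ (A ⊗ X)) ≫ (α_ A A X).inv ≫ m ▷ X =
      (α_ A A (A ⊗ X)).inv ≫ (α_ (A ⊗ A) A X).inv ≫ (m ▷ A ≫ m) ▷ X := by
  simp

lemma whiskerLeft_mulLeft_mulLeft_aux (m : A ⊗ A ⟶ A) (X : E) :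
    A ◁ ((α_ A A X).inv ≫ m ▷ X) ≫ (α_ A A X).inv ≫ m ▷ X =
      (α_ A A (A ⊗ X)).inv ≫ (α_ (A ⊗ A) A X).inv ≫
        ((α_ A A A).hom ≫ A ◁ m ≫ m) ▷ X := by
  simp

end Coherence

variable (K : E) [MonObj K]

/-- The unit `η ⊗ X : X ⟶ K ⊗ X`. -/
def insertUnit (X : E) : X ⟶ K ⊗ X := (λ_ X).inv ≫ MonObj.one ▷ X

/-- The multiplication `μ ⊗ X : K ⊗ (K ⊗ X) ⟶ K ⊗ X`. -/
def mulLeft (X : E) : K ⊗ (K ⊗ X) ⟶ K ⊗ X := (α_ K K X).inv ≫ MonObj.mul ▷ X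

/-- The map `K^{⊗ i} ⊗ η ⊗ K^{⊗ (n - i)} : K^{⊗ n} ⟶ K^{⊗ (n + 1)}`. -/
def unitAt : (n : ℕ) → Fin (n + 1) → (tensorPow K n ⟶ tensorPow K (n + 1))
  | n, ⟨0, _⟩ => insertUnit K (tensorPow K n)
  | n + 1, ⟨i + 1, h⟩ => K ◁ unitAt n ⟨i, Nat.lt_of_succ_lt_succ h⟩

/-- The map `K^{⊗ i} ⊗ μ ⊗ K^{⊗ (n - i)} : K^{⊗ (n + 2)} ⟶ K^{⊗ (n + 1)}`. -/
def mulAt : (n : ℕ) → Fin (n + 1) → (tensorPow K (n + 2) ⟶ tensorPow K (n + 1))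
  | n, ⟨0, _⟩ => mulLeft K (tensorPow K n)
  | n + 1, ⟨i + 1, h⟩ => K ◁ mulAt n ⟨i, Nat.lt_of_succ_lt_succ h⟩

/-- The restriction of a monotone map to the complement of `0`. -/
def tailMap {a b : ℕ} (f : Fin (a + 1) →o Fin b) : Fin a →o Fin b :=
  f.comp (Fin.succOrderEmb a).toOrderHom

/-- The shift of a monotone map that avoids `0`. -/
def predMap {a b : ℕ} (f : Fin a →o Fin (b + 1)) (h : ∀ i, f i ≠ 0) : Fin a →o Fin b where
  toFun i := (f i).pred (h i)
  monotone' _ _ hij := Fin.pred_le_pred_iff.2 (f.monotone hij)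

lemma ne_zero_of_zero {a b : ℕ} (f : Fin (a + 1) →o Fin (b + 1)) (h : f 0 ≠ 0)
    (i : Fin (a + 1)) : f i ≠ 0 := fun hi =>
  h (le_antisymm (hi ▸ f.monotone (Fin.zero_le i)) (Fin.zero_le _))

/-- The map `K^{⊗ a} ⟶ K^{⊗ b}` induced by a monotone map `Fin a → Fin b`: the factors in each
fibre are multiplied in order, and units are inserted at the points with empty fibre. -/
def monotoneTensor : (a b : ℕ) → (Fin a →o Fin b) → (tensorPow K a ⟶ tensorPow K b)
  | 0, 0, _ => 𝟙 _
  | 0, b + 1, f => monotoneTensor 0 b (predMap f (fun i => i.elim0)) ≫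
      insertUnit K (tensorPow K b)
  | _ + 1, 0, f => (f 0).elim0
  | a + 1, b + 1, f =>
      if h : f 0 = 0 then
        K ◁ monotoneTensor a (b + 1) (tailMap f) ≫ mulLeft K (tensorPow K b)
      else
        monotoneTensor (a + 1) b (predMap f (ne_zero_of_zero f h)) ≫
          insertUnit K (tensorPow K b)
termination_by a b => a + b

lemma insertUnit_naturality {X Y : E} (f : X ⟶ Y) :
    f ≫ insertUnit K Y = insertUnit K X ≫ K ◁ f := by
  simp only [insertUnit, Category.assoc, ← whisker_exchange]
  exact leftUnitor_inv_naturality_assoc f _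

lemma mulLeft_naturality {X Y : E} (f : X ⟶ Y) :
    K ◁ K ◁ f ≫ mulLeft K Y = mulLeft K X ≫ K ◁ f := by
  simp only [mulLeft, Category.assoc, ← whisker_exchange]
  exact associator_inv_naturality_right_assoc _ _ f _

lemma insertUnit_mulLeft (X : E) : insertUnit K (K ⊗ X) ≫ mulLeft K X = 𝟙 _ := by
  refine (insertUnit_mulLeft_aux _ _ X).trans ?_
  rw [MonObj.one_mul, Iso.inv_hom_id, id_whiskerRight]

lemma whiskerLeft_insertUnit_mulLeft (X : E) : K ◁ insertUnit K X ≫ mulLeft K X = 𝟙 _ := by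
  refine (whiskerLeft_insertUnit_mulLeft_aux _ _ X).trans ?_
  rw [MonObj.mul_one, Iso.inv_hom_id, id_whiskerRight]

lemma mulLeft_mulLeft (X : E) :
    mulLeft K (K ⊗ X) ≫ mulLeft K X = K ◁ mulLeft K X ≫ mulLeft K X := by
  refine (mulLeft_mulLeft_aux _ X).trans (Eq.trans ?_ (whiskerLeft_mulLeft_mulLeft_aux _ X).symm)
  rw [MonObj.mul_assoc]

lemma monotoneTensor_of_zero {a b : ℕ} (f : Fin (a + 1) →o Fin (b + 1)) (h : f 0 = 0) :
    monotoneTensor K (a + 1) (b + 1) f =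
      K ◁ monotoneTensor K a (b + 1) (tailMap f) ≫ mulLeft K (tensorPow K b) := by
  rw [monotoneTensor, dif_pos h]
  rfl

lemma monotoneTensor_of_ne {a b : ℕ} (f : Fin a →o Fin (b + 1)) (h : ∀ i, f i ≠ 0) :
    monotoneTensor K a (b + 1) f =
      monotoneTensor K a b (predMap f h) ≫ insertUnit K (tensorPow K b) := by
  cases a with
  | zero =>
    rw [monotoneTensor]
    rfl
  | succ a =>
    rw [monotoneTensor, dif_neg (h 0)]
    rfl

lemma monotoneTensor_id : ∀ n : ℕ, monotoneTensor K n n OrderHom.id = 𝟙 (tensorPow K n)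
  | 0 => by rw [monotoneTensor]
  | n + 1 => by
    rw [monotoneTensor_of_zero K OrderHom.id rfl,
      monotoneTensor_of_ne K (tailMap OrderHom.id) (fun i => Fin.succ_ne_zero i)]
    have h : predMap (tailMap (OrderHom.id : Fin (n + 1) →o Fin (n + 1)))
        (fun i => Fin.succ_ne_zero i) = OrderHom.id := by
      ext i
      rfl
    rw [h, monotoneTensor_id n, Category.id_comp]
    exact whiskerLeft_insertUnit_mulLeft K _

lemma insert_step {A P Q : E} {p : A ⟶ P} {q : P ⟶ K ⊗ Q} :
    (p ≫ insertUnit K P) ≫ K ◁ q ≫ mulLeft K Q = p ≫ q := by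
  rw [Category.assoc, ← Category.assoc (insertUnit K P), ← insertUnit_naturality,
    Category.assoc, insertUnit_mulLeft, Category.comp_id]

lemma mul_step {A P Q : E} {p : A ⟶ K ⊗ P} {q : P ⟶ K ⊗ Q} :
    (K ◁ p ≫ mulLeft K P) ≫ K ◁ q ≫ mulLeft K Q =
      K ◁ (p ≫ K ◁ q ≫ mulLeft K Q) ≫ mulLeft K Q := by
  rw [Category.assoc, ← Category.assoc (mulLeft K P), ← mulLeft_naturality, Category.assoc,
    mulLeft_mulLeft]
  simp only [whiskerLeft_comp, Category.assoc]

lemma monotoneTensor_comp (a b c : ℕ) (f : Fin a →o Fin b) (g : Fin b →o Fin c) :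
    monotoneTensor K a c (g.comp f) = monotoneTensor K a b f ≫ monotoneTensor K b c g := by
  induction hN : a + b + c using Nat.strong_induction_on generalizing a b c with
  | _ N ih =>
  subst hN
  match c, b, a with
  | 0, b + 1, _ => exact (g 0).elim0
  | 0, 0, a + 1 => exact (f 0).elim0
  | 0, 0, 0 =>
    rw [monotoneTensor, monotoneTensor, monotoneTensor]
    exact (Category.comp_id _).symm
  | c + 1, b, a =>
    by_cases hg : ∀ i, g i ≠ 0
    · have h := ih _ (by lia) a b c f (predMap g hg) rfl
      rw [monotoneTensor_of_ne K g hg]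
      refine (monotoneTensor_of_ne K (g.comp f) (fun i => hg (f i))).trans ?_
      refine Eq.trans ?_ (Category.assoc _ _ _)
      exact congrArg (· ≫ insertUnit K (tensorPow K c)) h
    · match b with
      | 0 => exact absurd (fun i => i.elim0) hg
      | b + 1 =>
        have hg0 : g 0 = 0 := by
          by_contra h
          exact hg (ne_zero_of_zero g h)
        by_cases hf : ∀ i, f i ≠ 0
        · rw [monotoneTensor_of_zero K g hg0, monotoneTensor_of_ne K f hf]
          refine Eq.trans ?_ (insert_step K).symm
          refine Eq.trans ?_ (ih _ (by lia) a b (c + 1) (predMap f hf) (tailMap g) rfl)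
          congr 1
          ext i
          change (g (f i) : ℕ) = g ((f i).pred (hf i)).succ
          rw [Fin.succ_pred]
        · match a with
          | 0 => exact absurd (fun i => i.elim0) hf
          | a + 1 =>
            have hf0 : f 0 = 0 := by
              by_contra h
              exact hf (ne_zero_of_zero f h)
            have h := ih _ (by lia) a (b + 1) (c + 1) (tailMap f) g rfl
            rw [monotoneTensor_of_zero K g hg0] at h
            have hgf : (g.comp f) 0 = 0 := (congrArg g hf0).trans hg0
            rw [monotoneTensor_of_zero K f hf0, monotoneTensor_of_zero K g hg0]
            refine (monotoneTensor_of_zero K (g.comp f) hgf).trans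
              (Eq.trans ?_ (mul_step K).symm)
            exact congrArg (fun q => K ◁ q ≫ mulLeft K (tensorPow K c)) h

lemma monotoneTensor_cons {a b : ℕ} (f : Fin (a + 1) →o Fin (b + 1)) (g : Fin a →o Fin b)
    (h : f 0 = 0) (hfg : ∀ i : Fin a, f i.succ = (g i).succ) :
    monotoneTensor K (a + 1) (b + 1) f = K ◁ monotoneTensor K a b g := by
  have h0 : ∀ i, tailMap f i ≠ 0 := fun i hi => Fin.succ_ne_zero _ ((hfg i).symm.trans hi)
  have h1 : predMap (tailMap f) h0 = g := by
    ext i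
    exact congrArg Fin.val ((Fin.pred_eq_iff_eq_succ (h0 i)).2 (hfg i))
  rw [monotoneTensor_of_zero K f h, monotoneTensor_of_ne K (tailMap f) h0, h1]
  refine (congrArg (· ≫ _) (whiskerLeft_comp K _ _)).trans ((Category.assoc _ _ _).trans ?_)
  exact (congrArg (_ ≫ ·) (whiskerLeft_insertUnit_mulLeft K _)).trans (Category.comp_id _)

/-- The cobar construction `R_K` of a monoid `K`: the cosimplicial object with
`R_K^n = K^{⊗ (n + 1)}` whose cofaces insert units and whose codegeneracies multiply neighbouring
factors, see `cobar_δ` and `cobar_σ`. -/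
def cobar : SimplexCategory ⥤ E where
  obj n := tensorPow K (n.len + 1)
  map f := monotoneTensor K _ _ f.toOrderHom
  map_id n := monotoneTensor_id K _
  map_comp f g := monotoneTensor_comp K _ _ _ f.toOrderHom g.toOrderHom

lemma monotoneTensor_succAbove : ∀ (n : ℕ) (i : Fin (n + 1)),
    monotoneTensor K n (n + 1) (Fin.succAboveOrderEmb i).toOrderHom = unitAt K n i
  | _, ⟨0, h⟩ => by
    have h0 : ∀ j, (Fin.succAboveOrderEmb (⟨0, h⟩ : Fin _)).toOrderHom j ≠ 0 :=
      fun j => Fin.succ_ne_zero j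
    have h1 : predMap _ h0 = OrderHom.id := by
      ext j
      rfl
    rw [monotoneTensor_of_ne K _ h0, h1, monotoneTensor_id, Category.id_comp, unitAt]
  | n + 1, ⟨i + 1, h⟩ => by
    have ih := monotoneTensor_succAbove n ⟨i, Nat.lt_of_succ_lt_succ h⟩
    refine (monotoneTensor_cons K _
      (Fin.succAboveOrderEmb ⟨i, Nat.lt_of_succ_lt_succ h⟩).toOrderHom ?_ ?_).trans
      (congrArg (K ◁ ·) ih)
    · exact Fin.succ_succAbove_zero ⟨i, Nat.lt_of_succ_lt_succ h⟩
    · intro j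
      exact Fin.succ_succAbove_succ ⟨i, Nat.lt_of_succ_lt_succ h⟩ j

lemma monotoneTensor_predAbove : ∀ (n : ℕ) (i : Fin (n + 1)),
    monotoneTensor K (n + 2) (n + 1) i.predAboveOrderHom = mulAt K n i
  | n, ⟨0, h⟩ => by
    have h0 : (Fin.predAboveOrderHom (⟨0, h⟩ : Fin (n + 1))) 0 = 0 := by
      simp [Fin.predAboveOrderHom]
    have h1 : tailMap (Fin.predAboveOrderHom (⟨0, h⟩ : Fin (n + 1))) = OrderHom.id := by
      ext j
      exact congrArg Fin.val (Fin.predAbove_zero_succ (n := n + 1) (i := j))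
    rw [monotoneTensor_of_zero K _ h0, h1, monotoneTensor_id]
    refine (congrArg (· ≫ _) (whiskerLeft_id _ _)).trans ((Category.id_comp _).trans ?_)
    cases n <;> rfl
  | n + 1, ⟨i + 1, h⟩ => by
    have ih := monotoneTensor_predAbove n ⟨i, Nat.lt_of_succ_lt_succ h⟩
    refine (monotoneTensor_cons K _
      (Fin.predAboveOrderHom ⟨i, Nat.lt_of_succ_lt_succ h⟩) ?_ ?_).trans
      (congrArg (K ◁ ·) ih)
    · simp [Fin.predAboveOrderHom]
    · intro j
      exact Fin.succ_predAbove_succ ⟨i, Nat.lt_of_succ_lt_succ h⟩ j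

/-- The coface `d^i` inserts a unit in position `i`. -/
lemma cobar_δ {n : ℕ} (i : Fin (n + 2)) :
    (cobar K).map (SimplexCategory.δ i) = unitAt K (n + 1) i :=
  monotoneTensor_succAbove K (n + 1) i

/-- The codegeneracy `s^i` multiplies the factors in positions `i` and `i + 1`. -/
lemma cobar_σ {n : ℕ} (i : Fin (n + 1)) :
    (cobar K).map (SimplexCategory.σ i) = mulAt K n i :=
  monotoneTensor_predAbove K n i

open scoped MonObj

/-- A twist map for a monoid `(K, η, μ)`. The unitors and associators are written out; for a strict
monoidal category they are identities. -/
structure IsTwistMap (t : K ⊗ K ⟶ K ⊗ K) : Prop where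
  /-- `μ ∘ t = μ` -/
  twist_mul : t ≫ μ[K] = μ[K]
  /-- `t ∘ (K ⊗ η) = η ⊗ K` -/
  unit_right_twist : (ρ_ K).inv ≫ K ◁ η[K] ≫ t = (λ_ K).inv ≫ η[K] ▷ K
  /-- `t ∘ (η ⊗ K) = K ⊗ η` -/
  unit_left_twist : (λ_ K).inv ≫ η[K] ▷ K ≫ t = (ρ_ K).inv ≫ K ◁ η[K]
  /-- `t ∘ (μ ⊗ K) = (K ⊗ μ) ∘ (t ⊗ K) ∘ (K ⊗ t)` -/
  mul_left_twist : μ[K] ▷ K ≫ t =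
    (α_ K K K).hom ≫ K ◁ t ≫ (α_ K K K).inv ≫ t ▷ K ≫ (α_ K K K).hom ≫ K ◁ μ[K]
  /-- `t ∘ (K ⊗ μ) = (μ ⊗ K) ∘ (K ⊗ t) ∘ (t ⊗ K)` -/
  mul_right_twist : K ◁ μ[K] ≫ t =
    (α_ K K K).inv ≫ t ▷ K ≫ (α_ K K K).hom ≫ K ◁ t ≫ (α_ K K K).inv ≫ μ[K] ▷ K

end Cobar

end TwistOperad

/-! The operad `TW` is the operad of endomorphisms of a universal example. `TwistWord` is the free
monoidal category on a monoid `gen` with a twist map. Its objects and morphisms form types in the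
lowest universe, so one small operad serves all `E`. Any monoid `K` with a twist map in any monoidal
category is the image of `gen` under a functor `eval` that respects tensor products, and evaluation
carries operations on the cobar construction of `gen` to operations on that of `K`. The action is
thus formal, and the real content is the contractibility of the spaces of operations, which is
proved for every monoid with a twist map.

These spaces differ from the mapping spaces of the endomorphism operad in two ways. An `AugSimplex`
stores its components as a compatible family, so no products are required in `TwistWord`. The
families also include the augmented degree `a = 0`, where `K^{⊗ 0}` is the unit object, and the
component there is fixed to be the canonical map `unitPow`.

Contractibility comes from a cone construction natural in the simplex. Let `φ` be a simplex with `b`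
vertices and add a new first vertex. A monotone `σ : Fin a → Fin (b + 1)` cuts the `a` factors of
`K^{⊗ a}` into an initial block over the new vertex and a rest over the old ones. On the rest the
cone is `φ`. In the block, the leading factors of the `N` copies of `K ⊗ K^{⊗ (a - 1)}` are moved to
the left by means of the twist and multiplied (`merge`), and the recursion continues with `K^{⊗ (a -
1)}`. If all factors lie over the new vertex, the recursion ends in degree `0`, where the value is
prescribed. Hence the cone point is the same for all `φ`, which is the purpose of the augmentation.

The axioms of a twist map are what makes the cone compatible with cofaces and codegeneracies
(`coneComponent_naturality`). The axioms for `η ⊗ K` and `μ ⊗ K` make the crossing `K^{⊗ n} ⊗ K ⟶ K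
⊗ K^{⊗ n}` natural in the first variable (`crossingNatural_monotoneTensor`); those for `K ⊗ η` and
`K ⊗ μ` make it compatible with the monoid structure in the second (`isCrossing_pow`). The axiom `μ
∘ t = μ` reconciles the two orders in which factors get multiplied (`mulLeft_mergeTwo`).

Finally, `contractibleSpace_toTop` turns a natural cone with a constant cone point into a straight
line contraction of the realization. -/

namespace TwistOperad

universe w

/-! ### Natural cones contract the geometric realization. -/

section Contraction

/-- The monotone map `Fin (a + 1) → Fin (b + 1)` that fixes `0` and is `f` on the complements. -/
def coneOrderHom {a b : ℕ} (f : Fin a →o Fin b) : Fin (a + 1) →o Fin (b + 1) where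
  toFun := Fin.cases 0 (fun i => (f i).succ)
  monotone' i j hij := by
    induction i using Fin.cases with
    | zero => exact Fin.zero_le _
    | succ i =>
      induction j using Fin.cases with
      | zero => exact absurd hij (by simp)
      | succ j => simpa using f.monotone (Fin.succ_le_succ_iff.1 hij)

@[simp]
lemma coneOrderHom_zero {a b : ℕ} (f : Fin a →o Fin b) : coneOrderHom f 0 = 0 := rfl

@[simp]
lemma coneOrderHom_succ {a b : ℕ} (f : Fin a →o Fin b) (i : Fin a) :
    coneOrderHom f i.succ = (f i).succ := rfl

/-- The join of a morphism of the simplex category with the identity of `⦋0⦌`. -/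
def coneHom {k l : SimplexCategory} (θ : k ⟶ l) :
    SimplexCategory.mk (k.len + 1) ⟶ SimplexCategory.mk (l.len + 1) :=
  SimplexCategory.Hom.mk (coneOrderHom θ.toOrderHom)

/-- The inclusion of the face opposite to the cone point. -/
def coneFace (k : SimplexCategory) : k ⟶ SimplexCategory.mk (k.len + 1) :=
  SimplexCategory.Hom.mk (Fin.succOrderEmb (k.len + 1)).toOrderHom

/-- The inclusion of the cone point. -/
def conePoint (k : SimplexCategory) : SimplexCategory.mk 0 ⟶ SimplexCategory.mk (k.len + 1) :=
  SimplexCategory.Hom.mk ⟨fun _ => 0, fun _ _ _ => le_rfl⟩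

/-- The straight line homotopy in a standard simplex from the face opposite to the cone point to
the cone point. -/
noncomputable def coneLine (n : ℕ) (x : stdSimplex ℝ (Fin (n + 1)) × unitInterval) :
    stdSimplex ℝ (Fin (n + 1 + 1)) :=
  ⟨(x.2 : ℝ) • ⇑(stdSimplex.vertex (S := ℝ) (0 : Fin (n + 1 + 1))) +
      (1 - (x.2 : ℝ)) • ⇑(stdSimplex.map Fin.succ x.1),
    convex_stdSimplex ℝ _ (stdSimplex.vertex (S := ℝ) (0 : Fin (n + 1 + 1))).2
      (stdSimplex.map Fin.succ x.1).2 x.2.2.1 (sub_nonneg.2 x.2.2.2) (add_sub_cancel _ _)⟩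

lemma continuous_coneLine (n : ℕ) : Continuous (coneLine n) := by
  refine Continuous.subtype_mk (Continuous.add ?_ ?_) _
  · exact (continuous_subtype_val.comp continuous_snd).smul continuous_const
  · exact (continuous_const.sub (continuous_subtype_val.comp continuous_snd)).smul
      (continuous_subtype_val.comp ((stdSimplex.continuous_map _).comp continuous_fst))

lemma coneLine_zero (n : ℕ) (p : stdSimplex ℝ (Fin (n + 1))) :
    coneLine n (p, 0) = stdSimplex.map Fin.succ p := by
  apply Subtype.ext
  simp [coneLine]
  rfl

lemma coneLine_one (n : ℕ) (p : stdSimplex ℝ (Fin (n + 1))) :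
    coneLine n (p, 1) = stdSimplex.vertex 0 := by
  apply Subtype.ext
  simp [coneLine]

/-- The induced map of simplices is affine, fixes the cone vertex and is `f` on the opposite face,
so it carries lines to the cone vertex to such lines, with the same parameter. -/
lemma map_coneLine {m n : ℕ} (f : Fin (m + 1) →o Fin (n + 1))
    (x : stdSimplex ℝ (Fin (m + 1)) × unitInterval) :
    stdSimplex.map (coneOrderHom f) (coneLine m x) = coneLine n (stdSimplex.map f x.1, x.2) := by
  apply Subtype.ext
  have h1 : stdSimplex.map (coneOrderHom f) (stdSimplex.map Fin.succ x.1) =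
      stdSimplex.map Fin.succ (stdSimplex.map f x.1) := by
    rw [stdSimplex.map_comp_apply, stdSimplex.map_comp_apply]
    rfl
  have h2 : stdSimplex.map (S := ℝ) (coneOrderHom f) (stdSimplex.vertex 0) =
      stdSimplex.vertex 0 :=
    stdSimplex.map_vertex _ _
  refine ((FunOnFinite.linearMap ℝ ℝ (coneOrderHom f)).map_add _ _).trans ?_
  rw [map_smul, map_smul]
  exact congrArg₂ (fun a b : stdSimplex ℝ (Fin (n + 1 + 1)) =>
    (x.2 : ℝ) • ⇑a + (1 - (x.2 : ℝ)) • ⇑b) h2 h1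

/-- The singular simplex of the realization that is given by a simplex. -/
noncomputable def realizeSimplex (S : SSet.{w}) {n : SimplexCategoryᵒᵖ} (x : S.obj n) :
    C(stdSimplex ℝ (Fin (n.unop.len + 1)), SSet.toTop.obj S) :=
  TopCat.toSSetObjEquiv _ n ((sSetTopAdj.unit.app S).app n x)

lemma toSSetObjEquiv_map {X : TopCat.{w}} {n m : SimplexCategoryᵒᵖ} (θ : n ⟶ m)
    (x : (TopCat.toSSet.obj X).obj n) (p : stdSimplex ℝ (Fin (m.unop.len + 1))) :
    TopCat.toSSetObjEquiv X m ((TopCat.toSSet.obj X).map θ x) p =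
      TopCat.toSSetObjEquiv X n x (stdSimplex.map θ.unop.toOrderHom p) := rfl

lemma map_simplex_apply {S T : SSet.{w}} (f : S ⟶ T) {n m : SimplexCategoryᵒᵖ} (θ : n ⟶ m)
    (x : S.obj n) : f.app m (S.map θ x) = T.map θ (f.app n x) :=
  NatTrans.naturality_apply f θ x

lemma realizeSimplex_map (S : SSet.{w}) {n m : SimplexCategoryᵒᵖ} (θ : n ⟶ m) (x : S.obj n)
    (p : stdSimplex ℝ (Fin (m.unop.len + 1))) :
    realizeSimplex S (S.map θ x) p =
      realizeSimplex S x (stdSimplex.map θ.unop.toOrderHom p) := by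
  have h : (sSetTopAdj.unit.app S).app m (S.map θ x) =
      (TopCat.toSSet.obj (SSet.toTop.obj S)).map θ ((sSetTopAdj.unit.app S).app n x) :=
    map_simplex_apply (T := TopCat.toSSet.obj (SSet.toTop.obj S)) (sSetTopAdj.unit.app S) θ x
  exact (DFunLike.congr_fun (congrArg (TopCat.toSSetObjEquiv _ m) h) p).trans
    (toSSetObjEquiv_map θ _ p)

/-- Two maps out of a realization agree if they agree on all simplices. -/
lemma toTop_hom_ext {S : SSet.{w}} {Y : TopCat.{w}} {f g : SSet.toTop.obj S ⟶ Y}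
    (h : ∀ (n : SimplexCategoryᵒᵖ) (x : S.obj n) (p : stdSimplex ℝ (Fin (n.unop.len + 1))),
      f (realizeSimplex S x p) = g (realizeSimplex S x p)) : f = g := by
  apply (sSetTopAdj.homEquiv S Y).injective
  rw [Adjunction.homEquiv_unit, Adjunction.homEquiv_unit]
  ext n x
  apply (TopCat.toSSetObjEquiv Y n).injective
  ext p
  exact h n x p

/-- A compatible family of singular simplices gives a map out of the realization. -/
lemma exists_toTop_hom (S : SSet.{w}) (Y : TopCat.{w})
    (c : ∀ (n : SimplexCategoryᵒᵖ), S.obj n → C(stdSimplex ℝ (Fin (n.unop.len + 1)), Y))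
    (hc : ∀ {n m : SimplexCategoryᵒᵖ} (θ : n ⟶ m) (x : S.obj n)
      (p : stdSimplex ℝ (Fin (m.unop.len + 1))),
      c m (S.map θ x) p = c n x (stdSimplex.map θ.unop.toOrderHom p)) :
    ∃ f : SSet.toTop.obj S ⟶ Y, ∀ (n : SimplexCategoryᵒᵖ) (x : S.obj n)
      (p : stdSimplex ℝ (Fin (n.unop.len + 1))), f (realizeSimplex S x p) = c n x p := by
  have nat : ∀ {n m : SimplexCategoryᵒᵖ} (θ : n ⟶ m) (x : S.obj n),
      (TopCat.toSSetObjEquiv Y m).symm (c m (S.map θ x)) =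
        (TopCat.toSSet.obj Y).map θ ((TopCat.toSSetObjEquiv Y n).symm (c n x)) := by
    intro n m θ x
    rw [Equiv.symm_apply_eq]
    ext p
    rw [toSSetObjEquiv_map, Equiv.apply_symm_apply, hc]
  let H : S ⟶ TopCat.toSSet.obj Y :=
    { app n := ↾fun x => (TopCat.toSSetObjEquiv Y n).symm (c n x)
      naturality n m θ := ConcreteCategory.hom_ext _ _ (fun x => nat θ x) }
  refine ⟨(sSetTopAdj.homEquiv S Y).symm H, fun n x p => ?_⟩
  have h := (sSetTopAdj.homEquiv S Y).apply_symm_apply H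
  rw [Adjunction.homEquiv_unit] at h
  have h2 := congrArg (fun g : S ⟶ TopCat.toSSet.obj Y =>
    TopCat.toSSetObjEquiv Y n (g.app n x) p) h
  exact h2.trans (DFunLike.congr_fun ((TopCat.toSSetObjEquiv Y n).apply_symm_apply _) p)

/-- The realization of a simplicial set with a natural cone construction is contractible. -/
lemma contractibleSpace_toTop (S : SSet.{w})
    (s : ∀ k : SimplexCategory, S.obj (op k) → S.obj (op (SimplexCategory.mk (k.len + 1))))
    (b : S.obj (op (SimplexCategory.mk 0)))
    (hs : ∀ {k l : SimplexCategory} (θ : k ⟶ l) (x : S.obj (op l)),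
      s k (S.map θ.op x) = S.map (coneHom θ).op (s l x))
    (hface : ∀ (k : SimplexCategory) (x : S.obj (op k)), S.map (coneFace k).op (s k x) = x)
    (hpoint : ∀ (k : SimplexCategory) (x : S.obj (op k)), S.map (conePoint k).op (s k x) = b) :
    ContractibleSpace (SSet.toTop.obj S) := by
  -- The homotopy is built as a map into the path space, so that it can be glued from simplices by
  -- the adjunction and no realization of a product is involved. The simplex `x` gives the family of
  -- straight lines in its cone `s x`.
  obtain ⟨f, hf⟩ := exists_toTop_hom S (TopCat.of C(unitInterval, SSet.toTop.obj S))
    (fun n x => ((realizeSimplex S (s n.unop x)).comp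
      ⟨coneLine n.unop.len, continuous_coneLine _⟩).curry) (by
      intro n m θ x p
      ext t
      change realizeSimplex S (s m.unop (S.map θ.unop.op x)) (coneLine _ (p, t)) =
        realizeSimplex S (s n.unop x) (coneLine _ (_, t))
      rw [hs, realizeSimplex_map]
      exact congrArg _ (map_coneLine θ.unop.toOrderHom (p, t)))
  let b' := realizeSimplex S b (stdSimplex.vertex 0)
  have h0 : f ≫ TopCat.ofHom ⟨fun γ : C(unitInterval, SSet.toTop.obj S) => γ 0,
      continuous_eval_const 0⟩ = 𝟙 (SSet.toTop.obj S) := by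
    apply toTop_hom_ext
    intro n x p
    refine (DFunLike.congr_fun (hf n x p) 0).trans ?_
    change realizeSimplex S (s n.unop x) (coneLine _ (p, 0)) = realizeSimplex S x p
    rw [coneLine_zero]
    exact (realizeSimplex_map S (coneFace n.unop).op (s n.unop x) p).symm.trans
      (congrArg (realizeSimplex S · p) (hface n.unop x))
  have h1 : f ≫ TopCat.ofHom ⟨fun γ : C(unitInterval, SSet.toTop.obj S) => γ 1,
      continuous_eval_const 1⟩ =
        TopCat.ofHom (ContinuousMap.const (SSet.toTop.obj S) b') := by
    apply toTop_hom_ext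
    intro n x p
    refine (DFunLike.congr_fun (hf n x p) 1).trans ?_
    change realizeSimplex S (s n.unop x) (coneLine _ (p, 1)) = b'
    rw [coneLine_one]
    -- Vertex `0` of the larger simplex is the image of the only vertex of the `0`-simplex under
    -- `conePoint`, so the endpoint of the path depends only on the restriction of `s x` to the cone
    -- point, which is `b`.
    have h := realizeSimplex_map S (conePoint n.unop).op (s n.unop x) (stdSimplex.vertex 0)
    refine Eq.trans ?_ (h.symm.trans (congrArg (realizeSimplex S · _) (hpoint n.unop x)))
    exact congrArg _ (stdSimplex.map_vertex (S := ℝ) (conePoint n.unop).toOrderHom 0).symm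
  rw [contractible_iff_id_nullhomotopic]
  refine ⟨b', ⟨⟨⟨fun q => f q.2 q.1, ?_⟩, fun q => ?_, fun q => ?_⟩⟩⟩
  · have h2 : Continuous fun q : SSet.toTop.obj S × unitInterval =>
        (f.hom q.1 : C(unitInterval, SSet.toTop.obj S)) q.2 :=
      ContinuousMap.continuous_uncurry_of_continuous f.hom
    exact h2.comp continuous_swap
  · exact congrArg (fun g : SSet.toTop.obj S ⟶ SSet.toTop.obj S => g q) h0
  · exact congrArg (fun g : SSet.toTop.obj S ⟶ SSet.toTop.obj S => g q) h1

end Contraction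

/-! ### Functoriality of tensor powers. -/

section TensorPow

variable {C : Type u} [Category.{v} C] [MonoidalCategory C]

/-- The tensor power of a morphism. -/
abbrev tensorPowMap {X Y : C} (g : X ⟶ Y) (N : ℕ) : tensorPow X N ⟶ tensorPow Y N :=
  finTensorMap (fun _ => g)

lemma tensorPowMap_comp {X Y Z : C} (f : X ⟶ Y) (g : Y ⟶ Z) (N : ℕ) :
    tensorPowMap (f ≫ g) N = tensorPowMap f N ≫ tensorPowMap g N :=
  finTensorMap_comp _ _

lemma tensorPowMap_id (X : C) (N : ℕ) : tensorPowMap (𝟙 X) N = 𝟙 (tensorPow X N) :=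
  finTensorMap_id _

end TensorPow

/-! ### Crossing tensor powers past `K`, and merging the leading factors of several copies. -/

section Crossing

open scoped MonObj

variable {C : Type u} [Category.{v} C] [MonoidalCategory C] {K : C}

/-- A crossing of `X` and `K` and a twist of `K` give a crossing of `K ⊗ X` and `K`. -/
def consCrossing (t : K ⊗ K ⟶ K ⊗ K) {X : C} (p : X ⊗ K ⟶ K ⊗ X) :
    (K ⊗ X) ⊗ K ⟶ K ⊗ (K ⊗ X) :=
  (α_ K X K).hom ≫ K ◁ p ≫ (α_ K K X).inv ≫ t ▷ X ≫ (α_ K K X).hom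

/-- The crossing of `K^{⊗ n}` and `K` obtained from a twist of `K`. -/
def powCrossing (t : K ⊗ K ⟶ K ⊗ K) : (n : ℕ) → (tensorPow K n ⊗ K ⟶ K ⊗ tensorPow K n)
  | 0 => (λ_ K).hom ≫ (ρ_ K).inv
  | n + 1 => consCrossing t (powCrossing t n)

/-- The morphism `g` is compatible with crossings. -/
def CrossingNatural {X X' : C} (p : X ⊗ K ⟶ K ⊗ X) (p' : X' ⊗ K ⟶ K ⊗ X') (g : X ⟶ X') : Prop :=
  g ▷ K ≫ p' = p ≫ K ◁ g

lemma CrossingNatural.id {X : C} (p : X ⊗ K ⟶ K ⊗ X) : CrossingNatural p p (𝟙 X) := by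
  simp [CrossingNatural]

lemma CrossingNatural.comp {X X' X'' : C} {p : X ⊗ K ⟶ K ⊗ X} {p' : X' ⊗ K ⟶ K ⊗ X'}
    {p'' : X'' ⊗ K ⟶ K ⊗ X''} {g : X ⟶ X'} {h : X' ⟶ X''} (hg : CrossingNatural p p' g)
    (hh : CrossingNatural p' p'' h) : CrossingNatural p p'' (g ≫ h) := by
  unfold CrossingNatural at *
  rw [comp_whiskerRight, Category.assoc, hh, reassoc_of% hg, whiskerLeft_comp]

/-- The twist in `consCrossing` acts on factors disjoint from the one on which `g` acts, so only the
hypothesis on `p` and the interchange law are used. -/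
lemma CrossingNatural.whiskerLeft (t : K ⊗ K ⟶ K ⊗ K) {X X' : C} {p : X ⊗ K ⟶ K ⊗ X}
    {p' : X' ⊗ K ⟶ K ⊗ X'} {g : X ⟶ X'} (hg : CrossingNatural p p' g) :
    CrossingNatural (consCrossing t p) (consCrossing t p') (K ◁ g) := by
  unfold CrossingNatural at *
  calc (K ◁ g) ▷ K ≫ consCrossing t p'
      = (α_ K X K).hom ≫ K ◁ (g ▷ K ≫ p') ≫ (α_ K K X').inv ≫ t ▷ X' ≫ (α_ K K X').hom := by
        rw [consCrossing]; monoidal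
    _ = (α_ K X K).hom ≫ K ◁ p ≫ (α_ K K X).inv ≫ ((K ⊗ K) ◁ g ≫ t ▷ X') ≫
          (α_ K K X').hom := by
        rw [hg]; monoidal
    _ = _ := by
        rw [whisker_exchange, consCrossing]; monoidal

variable [MonObj K]

/-- The crossing `p` is compatible with the unit and the multiplication of `K`. -/
structure IsCrossing {X : C} (p : X ⊗ K ⟶ K ⊗ X) : Prop where
  unit : X ◁ η[K] ≫ p = (ρ_ X).hom ≫ (λ_ X).inv ≫ η[K] ▷ X
  mul : X ◁ μ[K] ≫ p =
    (α_ X K K).inv ≫ p ▷ K ≫ (α_ K X K).hom ≫ K ◁ p ≫ (α_ K K X).inv ≫ μ[K] ▷ X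

variable {t : K ⊗ K ⟶ K ⊗ K}

lemma IsTwistMap.unit_right (ht : IsTwistMap K t) :
    K ◁ η[K] ≫ t = (ρ_ K).hom ≫ (λ_ K).inv ≫ η[K] ▷ K := by
  rw [← ht.unit_right_twist, Iso.hom_inv_id_assoc]

lemma IsTwistMap.unit_left (ht : IsTwistMap K t) :
    η[K] ▷ K ≫ t = (λ_ K).hom ≫ (ρ_ K).inv ≫ K ◁ η[K] := by
  rw [← ht.unit_left_twist, Iso.hom_inv_id_assoc]

/-- A unit or a product first crosses `X`, by `hp`, and then the new factor, by the twist axioms for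
`K ⊗ η` and `K ⊗ μ`. -/
lemma IsCrossing.cons (ht : IsTwistMap K t) {X : C} {p : X ⊗ K ⟶ K ⊗ X} (hp : IsCrossing p) :
    IsCrossing (consCrossing t p) where
  unit := by
    calc (K ⊗ X) ◁ η[K] ≫ consCrossing t p
        = (α_ K X _).hom ≫ K ◁ (X ◁ η[K] ≫ p) ≫ (α_ K K X).inv ≫ t ▷ X ≫ (α_ K K X).hom := by
          rw [consCrossing]; monoidal
      _ = 𝟙 _ ⊗≫ (K ◁ η[K] ≫ t) ▷ X ⊗≫ 𝟙 _ := by rw [hp.unit]; monoidal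
      _ = _ := by rw [ht.unit_right]; monoidal
  mul := by
    calc (K ⊗ X) ◁ μ[K] ≫ consCrossing t p
        = 𝟙 _ ⊗≫ K ◁ (X ◁ μ[K] ≫ p) ⊗≫ t ▷ X ⊗≫ 𝟙 _ := by
          rw [consCrossing]; monoidal
      _ = 𝟙 _ ⊗≫ K ◁ p ▷ K ⊗≫ K ◁ K ◁ p ⊗≫ (K ◁ μ[K] ≫ t) ▷ X ⊗≫ 𝟙 _ := by
          rw [hp.mul]; monoidal
      -- Of the two factors that cross, the second passes `X` while the first passes the new factor.
      -- These moves are isolated here to be interchanged.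
      _ = 𝟙 _ ⊗≫ K ◁ p ▷ K ⊗≫ ((K ⊗ K) ◁ p ≫ t ▷ (K ⊗ X)) ⊗≫ K ◁ t ▷ X ⊗≫
            μ[K] ▷ K ▷ X ⊗≫ 𝟙 _ := by
          rw [ht.mul_right_twist]; monoidal
      _ = _ := by rw [whisker_exchange, consCrossing]; monoidal

lemma isCrossing_pow (ht : IsTwistMap K t) : ∀ n : ℕ, IsCrossing (powCrossing t n)
  | 0 => {
      unit := by
        change 𝟙_ C ◁ η[K] ≫ (λ_ K).hom ≫ (ρ_ K).inv =
          (ρ_ (𝟙_ C)).hom ≫ (λ_ (𝟙_ C)).inv ≫ η[K] ▷ 𝟙_ C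
        monoidal
      mul := by
        change 𝟙_ C ◁ μ[K] ≫ (λ_ K).hom ≫ (ρ_ K).inv = (α_ (𝟙_ C) K K).inv ≫
          ((λ_ K).hom ≫ (ρ_ K).inv) ▷ K ≫ (α_ K (𝟙_ C) K).hom ≫
            K ◁ ((λ_ K).hom ≫ (ρ_ K).inv) ≫ (α_ K K (𝟙_ C)).inv ≫ μ[K] ▷ 𝟙_ C
        monoidal }
  | n + 1 => (isCrossing_pow ht n).cons ht

/-- The factor that has crossed `X` passes the inserted unit because of `t ∘ (η ⊗ K) = K ⊗ η`;
nothing is required of `p`. -/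
lemma crossingNatural_insertUnit (ht : IsTwistMap K t) {X : C} (p : X ⊗ K ⟶ K ⊗ X) :
    CrossingNatural p (consCrossing t p) (insertUnit K X) := by
  calc insertUnit K X ▷ K ≫ consCrossing t p
      = 𝟙 _ ⊗≫ (η[K] ▷ (X ⊗ K) ≫ K ◁ p) ⊗≫ t ▷ X ⊗≫ 𝟙 _ := by
        rw [insertUnit, consCrossing]; monoidal
    _ = 𝟙 _ ⊗≫ p ⊗≫ (η[K] ▷ K ≫ t) ▷ X ⊗≫ 𝟙 _ := by
        rw [← whisker_exchange]; monoidal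
    _ = _ := by rw [ht.unit_left, insertUnit]; monoidal

/-- Passing a product is passing its two factors in turn, by the axiom for `t ∘ (μ ⊗ K)`; again `p`
is arbitrary. -/
lemma crossingNatural_mulLeft (ht : IsTwistMap K t) {X : C} (p : X ⊗ K ⟶ K ⊗ X) :
    CrossingNatural (consCrossing t (consCrossing t p)) (consCrossing t p) (mulLeft K X) := by
  calc mulLeft K X ▷ K ≫ consCrossing t p
      = 𝟙 _ ⊗≫ (μ[K] ▷ (X ⊗ K) ≫ K ◁ p) ⊗≫ t ▷ X ⊗≫ 𝟙 _ := by
        rw [mulLeft, consCrossing]; monoidal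
    _ = 𝟙 _ ⊗≫ K ◁ K ◁ p ⊗≫ (μ[K] ▷ K ≫ t) ▷ X ⊗≫ 𝟙 _ := by
        rw [← whisker_exchange]; monoidal
    _ = _ := by rw [ht.mul_left_twist, mulLeft, consCrossing, consCrossing]; monoidal

/-- Every `monotoneTensor` is assembled from unit insertions, left multiplications and whiskering
with `K`, and the preceding lemmas treat these one by one. -/
lemma crossingNatural_monotoneTensor (ht : IsTwistMap K t) (a b : ℕ) (f : Fin a →o Fin b) :
    CrossingNatural (powCrossing t a) (powCrossing t b) (monotoneTensor K a b f) := by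
  induction hN : a + b using Nat.strong_induction_on generalizing a b with
  | _ N ih =>
  subst hN
  match b, a with
  | 0, a + 1 => exact (f 0).elim0
  | 0, 0 =>
    rw [monotoneTensor]
    exact CrossingNatural.id _
  | b + 1, a =>
    by_cases h : ∀ i, f i ≠ 0
    · rw [monotoneTensor_of_ne K f h]
      exact (ih _ (by lia) a b _ rfl).comp (crossingNatural_insertUnit ht _)
    · match a with
      | 0 => exact absurd (fun i => i.elim0) h
      | a + 1 =>
        have h0 : f 0 = 0 := by
          by_contra h0
          exact h (ne_zero_of_zero f h0)
        rw [monotoneTensor_of_zero K f h0]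
        exact ((ih _ (by lia) a (b + 1) (tailMap f) rfl).whiskerLeft t).comp
          (crossingNatural_mulLeft ht _)

/-- Cross `X` and `K`, then multiply the two factors `K`. -/
def mergeTwo {X : C} (p : X ⊗ K ⟶ K ⊗ X) (Y : C) : (K ⊗ X) ⊗ (K ⊗ Y) ⟶ K ⊗ (X ⊗ Y) :=
  (α_ K X (K ⊗ Y)).hom ≫ K ◁ ((α_ X K Y).inv ≫ p ▷ Y ≫ (α_ K X Y).hom) ≫ mulLeft K (X ⊗ Y)

/-- Only the crossing meets `g`, and `hg` moves `g` past it; all else is interchange. -/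
lemma mergeTwo_naturality {X X' Y Y' : C} {p : X ⊗ K ⟶ K ⊗ X} {p' : X' ⊗ K ⟶ K ⊗ X'}
    {g : X ⟶ X'} (hg : CrossingNatural p p' g) (h : Y ⟶ Y') :
    (K ◁ g ⊗ₘ K ◁ h) ≫ mergeTwo p' Y' = mergeTwo p Y ≫ K ◁ (g ⊗ₘ h) := by
  unfold CrossingNatural at hg
  calc (K ◁ g ⊗ₘ K ◁ h) ≫ mergeTwo p' Y'
      = 𝟙 _ ⊗≫ K ◁ (g ▷ (K ⊗ Y) ≫ X' ◁ K ◁ h) ⊗≫ K ◁ p' ▷ Y' ⊗≫ μ[K] ▷ X' ▷ Y' ⊗≫ 𝟙 _ := by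
        rw [mergeTwo, mulLeft, MonoidalCategory.tensorHom_def]; monoidal
    _ = 𝟙 _ ⊗≫ K ◁ X ◁ K ◁ h ⊗≫ K ◁ (g ▷ K ≫ p') ▷ Y' ⊗≫ μ[K] ▷ X' ▷ Y' ⊗≫ 𝟙 _ := by
        rw [← whisker_exchange]; monoidal
    _ = 𝟙 _ ⊗≫ K ◁ ((X ⊗ K) ◁ h ≫ p ▷ Y') ⊗≫ ((K ⊗ K) ◁ (g ▷ Y') ≫ μ[K] ▷ (X' ⊗ Y'))
          ⊗≫ 𝟙 _ := by
        rw [hg]; monoidal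
    _ = 𝟙 _ ⊗≫ K ◁ p ▷ Y ⊗≫ ((K ⊗ K) ◁ (X ◁ h) ≫ μ[K] ▷ (X ⊗ Y')) ⊗≫ K ◁ g ▷ Y' ⊗≫ 𝟙 _ := by
        rw [whisker_exchange, whisker_exchange]; monoidal
    _ = 𝟙 _ ⊗≫ K ◁ p ▷ Y ⊗≫ μ[K] ▷ (X ⊗ Y) ⊗≫ K ◁ (X ◁ h ≫ g ▷ Y') ⊗≫ 𝟙 _ := by
        rw [whisker_exchange]; monoidal
    _ = _ := by
        rw [whisker_exchange, mergeTwo, mulLeft, MonoidalCategory.tensorHom_def]; monoidal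

/-- The unit of the second copy crosses `X` freely and is then absorbed by the unit of the first
copy. -/
lemma insertUnit_mergeTwo {X : C} {p : X ⊗ K ⟶ K ⊗ X} (hp : IsCrossing p) (Y : C) :
    (insertUnit K X ⊗ₘ insertUnit K Y) ≫ mergeTwo p Y = insertUnit K (X ⊗ Y) := by
  calc (insertUnit K X ⊗ₘ insertUnit K Y) ≫ mergeTwo p Y
      = 𝟙 _ ⊗≫ η[K] ▷ (X ⊗ Y) ⊗≫ K ◁ (X ◁ η[K] ≫ p) ▷ Y ⊗≫ μ[K] ▷ X ▷ Y ⊗≫ 𝟙 _ := by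
        simp only [insertUnit, mergeTwo, mulLeft, MonoidalCategory.tensorHom_def]; monoidal
    _ = 𝟙 _ ⊗≫ η[K] ▷ (X ⊗ Y) ⊗≫ (K ◁ η[K] ≫ μ[K]) ▷ X ▷ Y ⊗≫ 𝟙 _ := by
        rw [hp.unit]; monoidal
    _ = _ := by rw [MonObj.mul_one, insertUnit]; monoidal

/-- A product of four factors can be bracketed so that the middle two are multiplied first, and
there the twist is absorbed by `μ ∘ t = μ`. -/
lemma IsTwistMap.middle_twist_mul (ht : IsTwistMap K t) :
    μ[K] ▷ (K ⊗ K) ≫ K ◁ μ[K] ≫ μ[K] =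
      𝟙 _ ⊗≫ K ◁ t ▷ K ⊗≫ μ[K] ▷ (K ⊗ K) ≫ K ◁ μ[K] ≫ μ[K] := by
  have h : μ[K] ▷ (K ⊗ K) ≫ K ◁ μ[K] ≫ μ[K] = 𝟙 _ ⊗≫ K ◁ μ[K] ▷ K ⊗≫ K ◁ μ[K] ⊗≫ μ[K] := by
    calc μ[K] ▷ (K ⊗ K) ≫ K ◁ μ[K] ≫ μ[K]
        = (K ⊗ K) ◁ μ[K] ≫ μ[K] ▷ K ≫ μ[K] := (whisker_exchange_assoc _ _ _).symm
      _ = 𝟙 _ ⊗≫ K ◁ (K ◁ μ[K] ≫ μ[K]) ⊗≫ μ[K] := by rw [MonObj.mul_assoc]; monoidal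
      _ = 𝟙 _ ⊗≫ K ◁ ((α_ K K K).inv ≫ μ[K] ▷ K ≫ μ[K]) ⊗≫ μ[K] := by
        rw [MonObj.mul_assoc, Iso.inv_hom_id_assoc]
      _ = _ := by monoidal
  rw [h]
  calc _ = 𝟙 _ ⊗≫ K ◁ (t ≫ μ[K]) ▷ K ⊗≫ K ◁ μ[K] ⊗≫ μ[K] := by rw [ht.twist_mul]
    _ = _ := by monoidal

/-- Number the factors `K` from left to right. Multiplying within the copies first yields the
product `1·2·3·4`. Merging first lets factor `3` cross factor `2`, so the product has the middle
pair twisted. The two agree by `middle_twist_mul`. -/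
lemma mulLeft_mergeTwo (ht : IsTwistMap K t) {X : C} {p : X ⊗ K ⟶ K ⊗ X} (hp : IsCrossing p)
    (Y : C) :
    (mulLeft K X ⊗ₘ mulLeft K Y) ≫ mergeTwo p Y =
      mergeTwo (consCrossing t p) (K ⊗ Y) ≫ K ◁ mergeTwo p Y ≫ mulLeft K (X ⊗ Y) := by
  calc (mulLeft K X ⊗ₘ mulLeft K Y) ≫ mergeTwo p Y
      = 𝟙 _ ⊗≫ μ[K] ▷ (X ⊗ (K ⊗ K) ⊗ Y) ⊗≫ K ◁ (X ◁ μ[K] ≫ p) ▷ Y ⊗≫ μ[K] ▷ X ▷ Y ⊗≫ 𝟙 _ := by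
        simp only [mergeTwo, mulLeft, MonoidalCategory.tensorHom_def]; monoidal
    _ = 𝟙 _ ⊗≫ (μ[K] ▷ (X ⊗ (K ⊗ K) ⊗ Y) ≫
          K ◁ (𝟙 _ ⊗≫ p ▷ K ▷ Y ⊗≫ K ◁ p ▷ Y ⊗≫ 𝟙 ((K ⊗ K) ⊗ X ⊗ Y)))
          ⊗≫ K ◁ μ[K] ▷ X ▷ Y ⊗≫ μ[K] ▷ X ▷ Y ⊗≫ 𝟙 _ := by
        rw [hp.mul]; monoidal
    _ = 𝟙 _ ⊗≫ (K ⊗ K) ◁ p ▷ K ▷ Y ⊗≫ K ◁ K ◁ K ◁ p ▷ Y ⊗≫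
          (μ[K] ▷ (K ⊗ K) ≫ K ◁ μ[K] ≫ μ[K]) ▷ X ▷ Y ⊗≫ 𝟙 _ := by
        rw [← whisker_exchange]; monoidal
    -- All four factors have been collected on the left, so the twist of the middle pair can be
    -- introduced.
    _ = 𝟙 _ ⊗≫ (K ⊗ K) ◁ p ▷ K ▷ Y ⊗≫ K ◁ K ◁ K ◁ p ▷ Y ⊗≫
          (𝟙 _ ⊗≫ K ◁ t ▷ K ⊗≫ μ[K] ▷ (K ⊗ K) ≫ K ◁ μ[K] ≫ μ[K]) ▷ X ▷ Y ⊗≫ 𝟙 _ := by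
        rw [← ht.middle_twist_mul]
    _ = 𝟙 _ ⊗≫ (K ⊗ K) ◁ p ▷ K ▷ Y ⊗≫ ((K ⊗ K ⊗ K) ◁ (p ▷ Y) ≫
          (K ◁ t ≫ (α_ K K K).inv ≫ μ[K] ▷ K) ▷ ((K ⊗ X) ⊗ Y)) ⊗≫
          K ◁ μ[K] ▷ X ▷ Y ⊗≫ μ[K] ▷ X ▷ Y ⊗≫ 𝟙 _ := by
        monoidal
    _ = _ := by
        rw [whisker_exchange, mergeTwo, mergeTwo, mulLeft, mulLeft, consCrossing]; monoidal

/-- The map `(K ⊗ X)^{⊗ N} ⟶ K ⊗ X^{⊗ N}` that collects the factors `K` on the left by means of the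
crossing `p` and multiplies them. -/
def merge {X : C} (p : X ⊗ K ⟶ K ⊗ X) : (N : ℕ) → (tensorPow (K ⊗ X) N ⟶ K ⊗ tensorPow X N)
  | 0 => insertUnit K (𝟙_ C)
  | N + 1 => (K ⊗ X) ◁ merge p N ≫ mergeTwo p (tensorPow X N)

lemma merge_naturality {X X' : C} {p : X ⊗ K ⟶ K ⊗ X} {p' : X' ⊗ K ⟶ K ⊗ X'}
    {g : X ⟶ X'} (hg : CrossingNatural p p' g) : ∀ N : ℕ,
    tensorPowMap (K ◁ g) N ≫ merge p' N = merge p N ≫ K ◁ tensorPowMap g N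
  | 0 => by
    change 𝟙 _ ≫ insertUnit K (𝟙_ C) = insertUnit K (𝟙_ C) ≫ K ◁ 𝟙 _
    simp
  | N + 1 => by
    have ih := merge_naturality hg N
    change (K ◁ g ⊗ₘ tensorPowMap (K ◁ g) N) ≫ (K ⊗ X') ◁ merge p' N ≫ mergeTwo p' _ =
      ((K ⊗ X) ◁ merge p N ≫ mergeTwo p _) ≫ K ◁ (g ⊗ₘ tensorPowMap g N)
    rw [Category.assoc, ← mergeTwo_naturality hg, tensorHom_comp_whiskerLeft_assoc, ih,
      whiskerLeft_comp_tensorHom_assoc]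

lemma insertUnit_merge {X : C} {p : X ⊗ K ⟶ K ⊗ X} (hp : IsCrossing p) : ∀ N : ℕ,
    tensorPowMap (insertUnit K X) N ≫ merge p N = insertUnit K (tensorPow X N)
  | 0 => Category.id_comp _
  | N + 1 => by
    have ih := insertUnit_merge hp N
    change (insertUnit K X ⊗ₘ tensorPowMap (insertUnit K X) N) ≫
      (K ⊗ X) ◁ merge p N ≫ mergeTwo p _ = insertUnit K (X ⊗ tensorPow X N)
    rw [tensorHom_comp_whiskerLeft_assoc, ih, insertUnit_mergeTwo hp]

/-- There are two ways to reduce the two leading factors of each copy to a single `K`: multiply in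
each copy and merge, or merge twice and multiply. For two copies this is `mulLeft_mergeTwo`, and the
general case follows by adding one copy at a time. -/
lemma mulLeft_merge (ht : IsTwistMap K t) {X : C} {p : X ⊗ K ⟶ K ⊗ X} (hp : IsCrossing p) :
    ∀ N : ℕ, tensorPowMap (mulLeft K X) N ≫ merge p N =
      merge (consCrossing t p) N ≫ K ◁ merge p N ≫ mulLeft K (tensorPow X N)
  | 0 => by
    change 𝟙 _ ≫ insertUnit K (𝟙_ C) =
      insertUnit K (𝟙_ C) ≫ K ◁ insertUnit K (𝟙_ C) ≫ mulLeft K (𝟙_ C)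
    rw [whiskerLeft_insertUnit_mulLeft, Category.id_comp, Category.comp_id]
  | N + 1 => by
    have ih := mulLeft_merge ht hp N
    change (mulLeft K X ⊗ₘ tensorPowMap (mulLeft K X) N) ≫
      (K ⊗ X) ◁ merge p N ≫ mergeTwo p _ =
      ((K ⊗ K ⊗ X) ◁ merge (consCrossing t p) N ≫ mergeTwo (consCrossing t p) _) ≫
        K ◁ ((K ⊗ X) ◁ merge p N ≫ mergeTwo p _) ≫ mulLeft K (X ⊗ tensorPow X N)
    -- Naturality in the second variable alone lets the merge of the remaining copies slide past
    -- `mergeTwo`.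
    have h := mergeTwo_naturality (CrossingNatural.id (consCrossing t p)) (merge p N)
    rw [whiskerLeft_id, id_tensorHom, id_tensorHom] at h
    rw [tensorHom_comp_whiskerLeft_assoc, ih, whiskerLeft_comp, Category.assoc, Category.assoc,
      ← reassoc_of% h, ← mulLeft_mergeTwo ht hp, whiskerLeft_comp_tensorHom_assoc,
      whiskerLeft_comp_tensorHom_assoc]

end Crossing

/-! ### Tensor powers of the unit object. -/

section UnitPow

open FreeMonoidalCategory (project)

variable {C : Type u} [Category.{v} C] [MonoidalCategory C]

/-- The canonical isomorphism from a tensor power of the unit object to the unit object. -/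
def unitPow (C : Type u) [Category.{v} C] [MonoidalCategory C] :
    (n : ℕ) → (tensorPow (𝟙_ C) n ⟶ 𝟙_ C)
  | 0 => 𝟙 _
  | n + 1 => 𝟙_ C ◁ unitPow C n ≫ (λ_ (𝟙_ C)).hom

/-- The presenting words contain no letters, so `A` is arbitrary; it is there only to fit the
coherence argument through `IsStructural`. -/
lemma isStructural_unitPow (A : C) : ∀ n : ℕ,
    IsStructural A
      (presTensor (fun _ : Unit => A) (W := fun _ : Fin n => .unit) (fun _ => 𝟙 (𝟙_ C)))
      (X' := .unit) (𝟙 (𝟙_ C)) (unitPow C n)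
  | 0 => IsStructural.id (A := A) (X := .unit) (𝟙 (𝟙_ C))
  | n + 1 => by
    obtain ⟨c, hc⟩ := isStructural_unitPow A n
    refine ⟨𝟙_ _ ◁ c ≫ (λ_ (𝟙_ _)).hom, ?_⟩
    refine Eq.trans ?_ (congrArg (· ≫ _) (((project fun _ : Unit => A).map_comp _ _).trans
      (congrArg (· ≫ _) (project_map_whiskerLeft _ _ c)))).symm
    change (𝟙 (𝟙_ C) ⊗ₘ presTensor (fun _ : Unit => A) (W := fun _ : Fin n => .unit)
        (fun _ => 𝟙 (𝟙_ C))) ≫ 𝟙_ C ◁ unitPow C n ≫ (λ_ (𝟙_ C)).hom =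
      (𝟙_ C ◁ (project fun _ : Unit => A).map c ≫ (λ_ (𝟙_ C)).hom) ≫ 𝟙 (𝟙_ C)
    rw [tensorHom_comp_whiskerLeft_assoc, hc, Category.comp_id, id_tensorHom]
    exact congrArg (fun g : _ ⟶ 𝟙_ C => 𝟙_ C ◁ g ≫ (λ_ (𝟙_ C)).hom) (Category.comp_id _)

/-- Both sides are canonical, hence equal by coherence. This is why operadic composition preserves
the prescribed value in augmented degree. -/
lemma endComp_unitPow {n : ℕ} (m : Fin n → ℕ) :
    endComp m (unitPow C n) (fun i => unitPow C (m i)) = unitPow C (∑ i, m i) := by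
  have : IsIso (presTensor (fun _ : Unit => 𝟙_ C) (W := fun _ : Fin (∑ i, m i) => .unit)
      (fun _ => 𝟙 (𝟙_ C))) := by
    have : IsIso (𝟙 ((project fun _ : Unit => 𝟙_ C).obj .unit)) := inferInstance
    exact isIso_presTensor (fun _ : Unit => 𝟙_ C) (W := fun _ : Fin (∑ i, m i) => .unit)
      (fun _ => 𝟙 ((project fun _ : Unit => 𝟙_ C).obj .unit))
  refine IsStructural.unique (A := 𝟙_ C) ?_ (isStructural_unitPow (𝟙_ C) (∑ i, m i))
  exact (isStructural_regroup (𝟙_ C) m (W := fun _ => .unit) (fun _ => 𝟙 (𝟙_ C))).comp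
    ((IsStructural.finTensorMap fun i => isStructural_unitPow (𝟙_ C) (m i)).comp
      (isStructural_unitPow (𝟙_ C) n))

end UnitPow

/-! ### Operations on the augmented cobar construction and the cone on a simplex. -/

section AugmentedEndomorphisms

open scoped MonObj

variable {C : Type u} [Category.{v} C] [MonoidalCategory C]

/-- A simplex of dimension `b - 1` of the mapping space from the `N`-th power of the augmented cobar
construction of `K` to the augmented cobar construction, with prescribed component in augmented
degree. -/
@[ext]
structure AugSimplex (K : C) [MonObj K] (N b : ℕ) where
  /-- the components -/
  component (a : ℕ) (σ : Fin a →o Fin b) : tensorPow (tensorPow K a) N ⟶ tensorPow K a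
  naturality {a c : ℕ} (f : Fin a →o Fin c) (σ : Fin c →o Fin b) :
    tensorPowMap (monotoneTensor K a c f) N ≫ component c σ =
      component a (σ.comp f) ≫ monotoneTensor K a c f
  unital (σ : Fin 0 →o Fin b) : component 0 σ = unitPow C N

namespace AugSimplex

variable {K : C} [MonObj K] {N b : ℕ}

/-- Restriction along a monotone map. -/
def restrict (φ : AugSimplex K N b) {b' : ℕ} (θ : Fin b' →o Fin b) : AugSimplex K N b' where
  component a σ := φ.component a (θ.comp σ)
  naturality f σ := φ.naturality f (θ.comp σ)
  unital σ := φ.unital (θ.comp σ)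

/-- The simplex of dimension `-1`. -/
def empty (K : C) [MonObj K] (N : ℕ) : AugSimplex K N 0 where
  component
    | 0, _ => unitPow C N
    | _ + 1, σ => (σ 0).elim0
  naturality {a c} f σ := by
    match c, a with
    | _ + 1, _ => exact (σ 0).elim0
    | 0, _ + 1 => exact (f 0).elim0
    | 0, 0 =>
      have h : monotoneTensor K 0 0 f = 𝟙 _ := by rw [monotoneTensor]
      rw [h]
      refine (congrArg (· ≫ _) (finTensorMap_id _)).trans ((Category.id_comp _).trans ?_)
      exact (Category.comp_id _).symm
  unital _ := rfl

/-- The components of the cone on a simplex: the factors that lie over the cone point are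
multiplied. -/
def coneComponent (t : K ⊗ K ⟶ K ⊗ K) (φ : AugSimplex K N b) :
    (a : ℕ) → (Fin a →o Fin (b + 1)) → (tensorPow (tensorPow K a) N ⟶ tensorPow K a)
  -- This value is forced by `unital`. It also ends the recursion when all factors lie over the cone
  -- point, so that `φ` is then never consulted.
  | 0, _ => unitPow C N
  | a + 1, σ =>
      if h : σ 0 = 0 then merge (powCrossing t a) N ≫ K ◁ coneComponent t φ a (tailMap σ)
      else φ.component (a + 1) (predMap σ (ne_zero_of_zero σ h))

variable (t : K ⊗ K ⟶ K ⊗ K) (φ : AugSimplex K N b)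

lemma coneComponent_of_zero {a : ℕ} (σ : Fin (a + 1) →o Fin (b + 1)) (h : σ 0 = 0) :
    coneComponent t φ (a + 1) σ =
      merge (powCrossing t a) N ≫ K ◁ coneComponent t φ a (tailMap σ) := by
  rw [coneComponent, dif_pos h]
  rfl

lemma coneComponent_of_ne {a : ℕ} (σ : Fin a →o Fin (b + 1)) (h : ∀ i, σ i ≠ 0) :
    coneComponent t φ a σ = φ.component a (predMap σ h) := by
  cases a with
  | zero =>
    rw [coneComponent]
    exact (φ.unital _).symm
  | succ a => rw [coneComponent, dif_neg (h 0)]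

variable {t}

/-- Inductive step of `coneComponent_naturality` for a map that misses the point `0`; `x` and `y`
stand for cone components. The inserted units of all copies merge into a single unit. -/
lemma cone_unit_step {A X : C} {p : X ⊗ K ⟶ K ⊗ X} (hp : IsCrossing p) {f : A ⟶ X}
    {x : tensorPow A N ⟶ A} {y : tensorPow X N ⟶ X} (h : tensorPowMap f N ≫ y = x ≫ f) :
    tensorPowMap (f ≫ insertUnit K X) N ≫ merge p N ≫ K ◁ y = x ≫ f ≫ insertUnit K X := by
  rw [tensorPowMap_comp, Category.assoc, ← Category.assoc (tensorPowMap (insertUnit K X) N),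
    insertUnit_merge hp, ← insertUnit_naturality, ← Category.assoc, h, Category.assoc]

/-- Inductive step of `coneComponent_naturality` for a map that hits `0`. Multiplication is
exchanged with merging by `mulLeft_merge`, and `hf` allows the remaining map `f` to pass the merge.
-/
lemma cone_mul_step (ht : IsTwistMap K t) {A X : C} {q : A ⊗ K ⟶ K ⊗ A} {p : X ⊗ K ⟶ K ⊗ X}
    (hp : IsCrossing p) {f : A ⟶ K ⊗ X} (hf : CrossingNatural q (consCrossing t p) f)
    {x : tensorPow A N ⟶ A} {y : tensorPow X N ⟶ X}
    (h : tensorPowMap f N ≫ merge p N ≫ K ◁ y = x ≫ f) :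
    tensorPowMap (K ◁ f ≫ mulLeft K X) N ≫ merge p N ≫ K ◁ y =
      (merge q N ≫ K ◁ x) ≫ K ◁ f ≫ mulLeft K X := by
  rw [tensorPowMap_comp, Category.assoc, ← Category.assoc (tensorPowMap (mulLeft K X) N),
    mulLeft_merge ht hp, Category.assoc, Category.assoc, ← mulLeft_naturality,
    ← Category.assoc, merge_naturality hf, Category.assoc, Category.assoc,
    ← whiskerLeft_comp_assoc, ← whiskerLeft_comp_assoc, Category.assoc, h,
    whiskerLeft_comp_assoc]

lemma coneComponent_naturality (ht : IsTwistMap K t) (a c : ℕ) (f : Fin a →o Fin c)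
    (σ : Fin c →o Fin (b + 1)) :
    tensorPowMap (monotoneTensor K a c f) N ≫ coneComponent t φ c σ =
      coneComponent t φ a (σ.comp f) ≫ monotoneTensor K a c f := by
  -- The sum is the measure because each step removes a point either from the target of `f`, if `0`
  -- has empty fibre, or from its source.
  induction hM : a + c using Nat.strong_induction_on generalizing a c with
  | _ M ih =>
  subst hM
  by_cases hσ : ∀ i, σ i ≠ 0
  · rw [coneComponent_of_ne t φ σ hσ, coneComponent_of_ne t φ (σ.comp f) (fun i => hσ (f i))]
    exact φ.naturality f (predMap σ hσ)
  match c, a with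
  | 0, _ => exact absurd (fun i => i.elim0) hσ
  | c + 1, a =>
    have hσ0 : σ 0 = 0 := by
      by_contra h
      exact hσ (ne_zero_of_zero σ h)
    by_cases hf : ∀ i, f i ≠ 0
    · have h := ih _ (by lia) a c (predMap f hf) (tailMap σ) rfl
      have hc : (tailMap σ).comp (predMap f hf) = σ.comp f := by
        ext i
        change (σ ((f i).pred (hf i)).succ : ℕ) = σ (f i)
        rw [Fin.succ_pred]
      rw [hc] at h
      rw [monotoneTensor_of_ne K f hf, coneComponent_of_zero t φ σ hσ0]
      exact cone_unit_step (isCrossing_pow ht c) h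
    · match a with
      | 0 => exact absurd (fun i => i.elim0) hf
      | a + 1 =>
        have hf0 : f 0 = 0 := by
          by_contra h
          exact hf (ne_zero_of_zero f h)
        -- Only the source shrinks and `σ` stays, since further points may also be sent to `0`.
        have h := ih _ (by lia) a (c + 1) (tailMap f) σ rfl
        have hσf : (σ.comp f) 0 = 0 := (congrArg σ hf0).trans hσ0
        rw [monotoneTensor_of_zero K f hf0, coneComponent_of_zero t φ σ hσ0,
          coneComponent_of_zero t φ (σ.comp f) hσf]
        rw [coneComponent_of_zero t φ σ hσ0] at h
        exact cone_mul_step ht (isCrossing_pow ht c)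
          (crossingNatural_monotoneTensor ht a (c + 1) (tailMap f)) h

/-- The cone on a simplex. -/
def cone (ht : IsTwistMap K t) (φ : AugSimplex K N b) : AugSimplex K N (b + 1) where
  component := coneComponent t φ
  naturality f σ := coneComponent_naturality φ ht _ _ f σ
  unital _ := by rw [coneComponent]

/-- Composition with `coneOrderHom θ` does not change which factors lie over the cone point, so both
recursions strip off the same block and then apply `φ` along `θ`. -/
lemma restrict_cone_coneOrderHom (ht : IsTwistMap K t) {b' : ℕ} (θ : Fin b' →o Fin b) :
    (cone ht φ).restrict (coneOrderHom θ) = cone ht (φ.restrict θ) := by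
  ext a σ
  change coneComponent t φ a ((coneOrderHom θ).comp σ) = coneComponent t (φ.restrict θ) a σ
  induction a with
  | zero => rw [coneComponent, coneComponent]
  | succ a ih =>
    by_cases h : σ 0 = 0
    · rw [coneComponent_of_zero t _ σ h, coneComponent_of_zero t φ _
        ((congrArg (coneOrderHom θ) h).trans (coneOrderHom_zero θ)), ← ih (tailMap σ)]
      rfl
    · have h1 := ne_zero_of_zero σ h
      have h2 : ∀ i, ((coneOrderHom θ).comp σ) i = (θ (predMap σ h1 i)).succ := fun i =>
        (congrArg (coneOrderHom θ) (Fin.succ_pred (σ i) (h1 i)).symm).trans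
          (coneOrderHom_succ θ _)
      have h3 : ∀ i, ((coneOrderHom θ).comp σ) i ≠ 0 := fun i hi =>
        Fin.succ_ne_zero _ ((h2 i).symm.trans hi)
      rw [coneComponent_of_ne t _ σ h1, coneComponent_of_ne t φ _ h3]
      change φ.component _ _ = φ.component _ (θ.comp (predMap σ h1))
      congr 1
      ext i
      exact congrArg Fin.val ((Fin.pred_eq_iff_eq_succ (h3 i)).2 (h2 i))

/-- Nothing lies over the cone point here, so the recursion never starts. -/
lemma restrict_cone_succ (ht : IsTwistMap K t) :
    (cone ht φ).restrict (Fin.succOrderEmb b).toOrderHom = φ := by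
  ext a σ
  exact coneComponent_of_ne t φ _ (fun i => Fin.succ_ne_zero (σ i))

/-- The recursion strips off every factor and stops in augmented degree, so the cone point is
independent of the simplex. -/
lemma coneComponent_of_eq_zero {b' : ℕ} (ψ : AugSimplex K N b') {a : ℕ}
    (σ : Fin a →o Fin (b + 1)) (σ' : Fin a →o Fin (b' + 1)) (h : ∀ i, σ i = 0)
    (h' : ∀ i, σ' i = 0) : coneComponent t φ a σ = coneComponent t ψ a σ' := by
  induction a with
  | zero => rw [coneComponent, coneComponent]
  | succ a ih =>
    rw [coneComponent_of_zero t φ σ (h 0), coneComponent_of_zero t ψ σ' (h' 0),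
      ih (tailMap σ) (tailMap σ') (fun i => h i.succ) (fun i => h' i.succ)]

end AugSimplex

/-! ### The spaces of augmented operations, their contractibility and their operad structure. -/

variable (K : C) [MonObj K]

/-- The mapping space from the `N`-th power of the augmented cobar construction to the augmented
cobar construction. -/
def augSpace (N : ℕ) : SSet.{v} where
  obj k := AugSimplex K N (k.unop.len + 1)
  map θ := ↾fun φ => φ.restrict θ.unop.toOrderHom
  map_id _ := rfl
  map_comp _ _ := rfl

variable {K} in
lemma contractibleSpace_augSpace {t : K ⊗ K ⟶ K ⊗ K} (ht : IsTwistMap K t) (N : ℕ) :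
    ContractibleSpace (SSet.toTop.obj (augSpace K N)) := by
  refine contractibleSpace_toTop (augSpace K N) (fun k φ => AugSimplex.cone ht φ)
    -- The base vertex is the cone on the simplex of dimension `-1`.
    (AugSimplex.cone ht (AugSimplex.empty K N)) ?_ ?_ ?_
  · intro k l θ φ
    exact (AugSimplex.restrict_cone_coneOrderHom φ ht θ.toOrderHom).symm
  · intro k φ
    exact AugSimplex.restrict_cone_succ φ ht
  · intro k φ
    refine AugSimplex.ext (funext fun a => funext fun σ => ?_)
    exact AugSimplex.coneComponent_of_eq_zero φ _ _ _ (fun _ => rfl)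
      (fun _ => Subsingleton.elim (α := Fin 1) _ _)

variable {K} in
lemma component_augSpace_cast {k : SimplexCategoryᵒᵖ} {n n' : ℕ} (h : n = n')
    (φ : (augSpace K n).obj k) (a : ℕ) (σ : Fin a →o Fin (k.unop.len + 1)) :
    AugSimplex.component ((eqToHom (congrArg (augSpace K) h)).app k φ) a σ =
      powCast (tensorPow K a) h.symm ≫ AugSimplex.component φ a σ := by
  subst h
  exact (Category.id_comp _).symm

/-- The endomorphism operad of the augmented cobar construction, with prescribed components in
augmented degree. -/
noncomputable def augOperad : SimplicialOperad.{v} where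
  space := augSpace K
  one k :=
    { component a _ := (ρ_ (tensorPow K a)).hom
      naturality f _ := by
        have h := rightUnitor_naturality (monotoneTensor K _ _ f)
        rw [← tensorHom_id] at h
        exact h
      unital _ := by
        change (ρ_ (𝟙_ C)).hom = 𝟙_ C ◁ 𝟙 _ ≫ (λ_ (𝟙_ C)).hom
        rw [whiskerLeft_id, Category.id_comp, unitors_equal] }
  comp m x y :=
    { component a σ := endComp m (AugSimplex.component x a σ)
        (fun i => AugSimplex.component (y i) a σ)
      naturality f σ := endComp_naturality _ m (AugSimplex.naturality x f σ)
        (fun i => AugSimplex.naturality (y i) f σ)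
      unital σ := by
        rw [AugSimplex.unital x σ, funext fun i => AugSimplex.unital (y i) σ]
        exact endComp_unitPow m }
  map_one _ := rfl
  map_comp _ _ _ _ _ := rfl
  one_comp x h := by
    refine AugSimplex.ext (funext fun a => funext fun σ => ?_)
    exact (component_augSpace_cast h _ a σ).trans (endComp_one_left _ h.symm)
  comp_one x h := by
    refine AugSimplex.ext (funext fun a => funext fun σ => ?_)
    exact (component_augSpace_cast h _ a σ).trans (endComp_one_right _ h.symm)
  comp_assoc m p x y z h := by
    refine AugSimplex.ext (funext fun a => funext fun σ => ?_)
    exact (component_augSpace_cast h _ a σ).trans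
      (endComp_assoc m p _ _ (fun i j => AugSimplex.component (z i j) a σ) h.symm)

end AugmentedEndomorphisms

/-! ### The free monoidal category on a monoid with a twist map. -/

section FreeTwist

open scoped MonObj

/-- The objects of the free monoidal category on a monoid with a twist map: bracketed words in one
letter. -/
inductive TwistWord : Type
  | gen : TwistWord
  | unit : TwistWord
  | tensor : TwistWord → TwistWord → TwistWord

namespace TwistWord

/-- Formal morphisms between bracketed words, generated by the structural isomorphisms, a unit, a
multiplication and a twist. -/
inductive Pre : TwistWord → TwistWord → Type
  | id (X) : Pre X X
  | α_hom (X Y Z : TwistWord) : Pre ((X.tensor Y).tensor Z) (X.tensor (Y.tensor Z))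
  | α_inv (X Y Z : TwistWord) : Pre (X.tensor (Y.tensor Z)) ((X.tensor Y).tensor Z)
  | l_hom (X) : Pre (unit.tensor X) X
  | l_inv (X) : Pre X (unit.tensor X)
  | ρ_hom (X : TwistWord) : Pre (X.tensor unit) X
  | ρ_inv (X : TwistWord) : Pre X (X.tensor unit)
  | one : Pre unit gen
  | mul : Pre (gen.tensor gen) gen
  | twist : Pre (gen.tensor gen) (gen.tensor gen)
  | comp {X Y Z} (f : Pre X Y) (g : Pre Y Z) : Pre X Z
  | whiskerLeft (X : TwistWord) {Y₁ Y₂} (f : Pre Y₁ Y₂) : Pre (X.tensor Y₁) (X.tensor Y₂)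
  | whiskerRight {X₁ X₂} (f : Pre X₁ X₂) (Y : TwistWord) : Pre (X₁.tensor Y) (X₂.tensor Y)
  | tensor {W X Y Z} (f : Pre W Y) (g : Pre X Z) : Pre (W.tensor X) (Y.tensor Z)

/-- The congruence generated by the axioms of a monoidal category, of a monoid and of a twist
map. -/
inductive Rel : ∀ {X Y : TwistWord}, Pre X Y → Pre X Y → Prop
  | refl {X Y} (f : Pre X Y) : Rel f f
  | symm {X Y} (f g : Pre X Y) : Rel f g → Rel g f
  | trans {X Y} {f g h : Pre X Y} : Rel f g → Rel g h → Rel f h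
  | comp {X Y Z} {f f' : Pre X Y} {g g' : Pre Y Z} :
      Rel f f' → Rel g g' → Rel (f.comp g) (f'.comp g')
  | whiskerLeft (X) {Y Z} (f f' : Pre Y Z) :
      Rel f f' → Rel (f.whiskerLeft X) (f'.whiskerLeft X)
  | whiskerRight {Y Z} (f f' : Pre Y Z) (X) :
      Rel f f' → Rel (f.whiskerRight X) (f'.whiskerRight X)
  | tensor {W X Y Z} {f f' : Pre W X} {g g' : Pre Y Z} :
      Rel f f' → Rel g g' → Rel (f.tensor g) (f'.tensor g')
  | tensorHom_def {X₁ Y₁ X₂ Y₂} (f : Pre X₁ Y₁) (g : Pre X₂ Y₂) :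
      Rel (f.tensor g) ((f.whiskerRight X₂).comp (g.whiskerLeft Y₁))
  | comp_id {X Y} (f : Pre X Y) : Rel (f.comp (Pre.id _)) f
  | id_comp {X Y} (f : Pre X Y) : Rel ((Pre.id _).comp f) f
  | assoc {X Y U V : TwistWord} (f : Pre X U) (g : Pre U V) (h : Pre V Y) :
      Rel ((f.comp g).comp h) (f.comp (g.comp h))
  | id_tensorHom_id {X Y} : Rel ((Pre.id X).tensor (Pre.id Y)) (Pre.id _)
  | tensorHom_comp_tensorHom {X₁ Y₁ Z₁ X₂ Y₂ Z₂ : TwistWord} (f₁ : Pre X₁ Y₁) (f₂ : Pre X₂ Y₂)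
      (g₁ : Pre Y₁ Z₁) (g₂ : Pre Y₂ Z₂) :
      Rel ((f₁.tensor f₂).comp (g₁.tensor g₂)) ((f₁.comp g₁).tensor (f₂.comp g₂))
  | whiskerLeft_id (X Y) : Rel ((Pre.id Y).whiskerLeft X) (Pre.id (X.tensor Y))
  | id_whiskerRight (X Y) : Rel ((Pre.id X).whiskerRight Y) (Pre.id (X.tensor Y))
  | α_hom_inv {X Y Z} : Rel ((Pre.α_hom X Y Z).comp (Pre.α_inv X Y Z)) (Pre.id _)
  | α_inv_hom {X Y Z} : Rel ((Pre.α_inv X Y Z).comp (Pre.α_hom X Y Z)) (Pre.id _)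
  | associator_naturality {X₁ X₂ X₃ Y₁ Y₂ Y₃} (f₁ : Pre X₁ Y₁) (f₂ : Pre X₂ Y₂)
      (f₃ : Pre X₃ Y₃) :
      Rel (((f₁.tensor f₂).tensor f₃).comp (Pre.α_hom Y₁ Y₂ Y₃))
        ((Pre.α_hom X₁ X₂ X₃).comp (f₁.tensor (f₂.tensor f₃)))
  | ρ_hom_inv {X} : Rel ((Pre.ρ_hom X).comp (Pre.ρ_inv X)) (Pre.id _)
  | ρ_inv_hom {X} : Rel ((Pre.ρ_inv X).comp (Pre.ρ_hom X)) (Pre.id _)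
  | ρ_naturality {X Y} (f : Pre X Y) :
      Rel ((f.whiskerRight unit).comp (Pre.ρ_hom Y)) ((Pre.ρ_hom X).comp f)
  | l_hom_inv {X} : Rel ((Pre.l_hom X).comp (Pre.l_inv X)) (Pre.id _)
  | l_inv_hom {X} : Rel ((Pre.l_inv X).comp (Pre.l_hom X)) (Pre.id _)
  | l_naturality {X Y} (f : Pre X Y) :
      Rel ((f.whiskerLeft unit).comp (Pre.l_hom Y)) ((Pre.l_hom X).comp f)
  | pentagon {W X Y Z} :
      Rel (((Pre.α_hom W X Y).whiskerRight Z).comp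
          ((Pre.α_hom W (X.tensor Y) Z).comp ((Pre.α_hom X Y Z).whiskerLeft W)))
        ((Pre.α_hom (W.tensor X) Y Z).comp (Pre.α_hom W X (Y.tensor Z)))
  | triangle {X Y} :
      Rel ((Pre.α_hom X unit Y).comp ((Pre.l_hom Y).whiskerLeft X))
        ((Pre.ρ_hom X).whiskerRight Y)
  | one_mul : Rel ((Pre.one.whiskerRight gen).comp Pre.mul) (Pre.l_hom gen)
  | mul_one : Rel ((Pre.one.whiskerLeft gen).comp Pre.mul) (Pre.ρ_hom gen)
  | mul_assoc : Rel ((Pre.mul.whiskerRight gen).comp Pre.mul)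
      ((Pre.α_hom gen gen gen).comp ((Pre.mul.whiskerLeft gen).comp Pre.mul))
  | twist_mul : Rel (Pre.twist.comp Pre.mul) Pre.mul
  | unit_right_twist :
      Rel ((Pre.ρ_inv gen).comp ((Pre.one.whiskerLeft gen).comp Pre.twist))
        ((Pre.l_inv gen).comp (Pre.one.whiskerRight gen))
  | unit_left_twist :
      Rel ((Pre.l_inv gen).comp ((Pre.one.whiskerRight gen).comp Pre.twist))
        ((Pre.ρ_inv gen).comp (Pre.one.whiskerLeft gen))
  | mul_left_twist :
      Rel ((Pre.mul.whiskerRight gen).comp Pre.twist)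
        ((Pre.α_hom gen gen gen).comp ((Pre.twist.whiskerLeft gen).comp
          ((Pre.α_inv gen gen gen).comp ((Pre.twist.whiskerRight gen).comp
            ((Pre.α_hom gen gen gen).comp (Pre.mul.whiskerLeft gen))))))
  | mul_right_twist :
      Rel ((Pre.mul.whiskerLeft gen).comp Pre.twist)
        ((Pre.α_inv gen gen gen).comp ((Pre.twist.whiskerRight gen).comp
          ((Pre.α_hom gen gen gen).comp ((Pre.twist.whiskerLeft gen).comp
            ((Pre.α_inv gen gen gen).comp (Pre.mul.whiskerRight gen))))))

instance preSetoid (X Y : TwistWord) : Setoid (Pre X Y) :=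
  ⟨Rel, ⟨Rel.refl, Rel.symm _ _, Rel.trans⟩⟩

instance : Category.{0} TwistWord where
  Hom X Y := Quotient (preSetoid X Y)
  id X := ⟦Pre.id X⟧
  comp := Quotient.map₂ Pre.comp (fun _ _ hf _ _ hg => Rel.comp hf hg)
  id_comp := by
    rintro X Y ⟨f⟩
    exact Quotient.sound (.id_comp f)
  comp_id := by
    rintro X Y ⟨f⟩
    exact Quotient.sound (.comp_id f)
  assoc := by
    rintro W X Y Z ⟨f⟩ ⟨g⟩ ⟨h⟩
    exact Quotient.sound (.assoc f g h)

instance : MonoidalCategory TwistWord where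
  tensorObj X Y := tensor X Y
  tensorHom := Quotient.map₂ Pre.tensor (fun _ _ hf _ _ hg => Rel.tensor hf hg)
  whiskerLeft X _ _ f := Quot.map (fun f => Pre.whiskerLeft X f) (fun f f' => .whiskerLeft X f f') f
  whiskerRight f Y := Quot.map (fun f => Pre.whiskerRight f Y) (fun f f' => .whiskerRight f f' Y) f
  tensorHom_def {W X Y Z} := by
    rintro ⟨f⟩ ⟨g⟩
    exact Quotient.sound (.tensorHom_def _ _)
  id_tensorHom_id _ _ := Quot.sound .id_tensorHom_id
  tensorHom_comp_tensorHom {X₁ Y₁ Z₁ X₂ Y₂ Z₂} := by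
    rintro ⟨f₁⟩ ⟨f₂⟩ ⟨g₁⟩ ⟨g₂⟩
    exact Quotient.sound (.tensorHom_comp_tensorHom _ _ _ _)
  whiskerLeft_id X Y := Quot.sound (.whiskerLeft_id X Y)
  id_whiskerRight X Y := Quot.sound (.id_whiskerRight X Y)
  tensorUnit := unit
  associator X Y Z :=
    ⟨⟦.α_hom X Y Z⟧, ⟦.α_inv X Y Z⟧, Quotient.sound .α_hom_inv, Quotient.sound .α_inv_hom⟩
  associator_naturality {X₁ X₂ X₃ Y₁ Y₂ Y₃} := by
    rintro ⟨f₁⟩ ⟨f₂⟩ ⟨f₃⟩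
    exact Quotient.sound (.associator_naturality _ _ _)
  leftUnitor X := ⟨⟦.l_hom X⟧, ⟦.l_inv X⟧, Quotient.sound .l_hom_inv, Quotient.sound .l_inv_hom⟩
  leftUnitor_naturality {X Y} := by
    rintro ⟨f⟩
    exact Quotient.sound (.l_naturality _)
  rightUnitor X :=
    ⟨⟦.ρ_hom X⟧, ⟦.ρ_inv X⟧, Quotient.sound .ρ_hom_inv, Quotient.sound .ρ_inv_hom⟩
  rightUnitor_naturality {X Y} := by
    rintro ⟨f⟩
    exact Quotient.sound (.ρ_naturality _)
  pentagon _ _ _ _ := Quotient.sound .pentagon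
  triangle _ _ := Quotient.sound .triangle

instance : MonObj gen where
  one := ⟦.one⟧
  mul := ⟦.mul⟧
  one_mul := Quotient.sound .one_mul
  mul_one := Quotient.sound .mul_one
  mul_assoc := Quotient.sound .mul_assoc

/-- The universal twist map. -/
def genTwist : gen ⊗ gen ⟶ gen ⊗ gen := ⟦.twist⟧

lemma isTwistMap_genTwist : IsTwistMap gen genTwist where
  twist_mul := Quotient.sound .twist_mul
  unit_right_twist := Quotient.sound .unit_right_twist
  unit_left_twist := Quotient.sound .unit_left_twist
  mul_left_twist := Quotient.sound .mul_left_twist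
  mul_right_twist := Quotient.sound .mul_right_twist

variable {E : Type u} [Category.{v} E] [MonoidalCategory E] (K : E) [MonObj K]

/-- The interpretation of a word. -/
def evalObj : TwistWord → E
  | gen => K
  | unit => 𝟙_ E
  | tensor X Y => evalObj X ⊗ evalObj Y

variable (t : K ⊗ K ⟶ K ⊗ K)

/-- The interpretation of a formal morphism. -/
def evalPre : ∀ {X Y : TwistWord}, Pre X Y → (evalObj K X ⟶ evalObj K Y)
  | _, _, .id _ => 𝟙 _
  | _, _, .α_hom _ _ _ => (α_ _ _ _).hom
  | _, _, .α_inv _ _ _ => (α_ _ _ _).inv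
  | _, _, .l_hom _ => (λ_ _).hom
  | _, _, .l_inv _ => (λ_ _).inv
  | _, _, .ρ_hom _ => (ρ_ _).hom
  | _, _, .ρ_inv _ => (ρ_ _).inv
  | _, _, .one => η[K]
  | _, _, .mul => μ[K]
  | _, _, .twist => t
  | _, _, .comp f g => evalPre f ≫ evalPre g
  | _, _, .whiskerLeft X p => evalObj K X ◁ evalPre p
  | _, _, .whiskerRight p X => evalPre p ▷ evalObj K X
  | _, _, .tensor f g => evalPre f ⊗ₘ evalPre g

variable {K t}

lemma evalPre_eq (ht : IsTwistMap K t) {X Y : TwistWord} {f g : Pre X Y} (h : Rel f g) :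
    evalPre K t f = evalPre K t g := by
  induction h with
  | refl => rfl
  | symm _ _ _ h => exact h.symm
  | trans _ _ h h' => exact h.trans h'
  | comp _ _ h h' => exact congrArg₂ (· ≫ ·) h h'
  | whiskerLeft X _ _ _ h => exact congrArg (evalObj K X ◁ ·) h
  | whiskerRight _ _ X _ h => exact congrArg (· ▷ evalObj K X) h
  | tensor _ _ h h' => exact congrArg₂ (· ⊗ₘ ·) h h'
  | tensorHom_def => exact MonoidalCategory.tensorHom_def _ _
  | comp_id => exact Category.comp_id _
  | id_comp => exact Category.id_comp _
  | assoc => exact Category.assoc _ _ _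
  | id_tensorHom_id => exact MonoidalCategory.id_tensorHom_id _ _
  | tensorHom_comp_tensorHom => exact MonoidalCategory.tensorHom_comp_tensorHom _ _ _ _
  | whiskerLeft_id => exact MonoidalCategory.whiskerLeft_id _ _
  | id_whiskerRight => exact MonoidalCategory.id_whiskerRight _ _
  | α_hom_inv => exact Iso.hom_inv_id _
  | α_inv_hom => exact Iso.inv_hom_id _
  | associator_naturality => exact MonoidalCategory.associator_naturality _ _ _
  | ρ_hom_inv => exact Iso.hom_inv_id _
  | ρ_inv_hom => exact Iso.inv_hom_id _
  | ρ_naturality => exact MonoidalCategory.rightUnitor_naturality _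
  | l_hom_inv => exact Iso.hom_inv_id _
  | l_inv_hom => exact Iso.inv_hom_id _
  | l_naturality => exact MonoidalCategory.leftUnitor_naturality _
  | pentagon => exact MonoidalCategory.pentagon _ _ _ _
  | triangle => exact MonoidalCategory.triangle _ _
  | one_mul => exact MonObj.one_mul K
  | mul_one => exact MonObj.mul_one K
  | mul_assoc => exact MonObj.mul_assoc K
  | twist_mul => exact ht.twist_mul
  | unit_right_twist => exact ht.unit_right_twist
  | unit_left_twist => exact ht.unit_left_twist
  | mul_left_twist => exact ht.mul_left_twist
  | mul_right_twist => exact ht.mul_right_twist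

/-- The interpretation of words in a monoidal category with a monoid and a twist map. -/
def eval (ht : IsTwistMap K t) : TwistWord ⥤ E where
  obj := evalObj K
  map := Quotient.lift (evalPre K t) (fun _ _ h => evalPre_eq ht h)
  map_comp := by
    rintro _ _ _ ⟨_⟩ ⟨_⟩
    rfl

end TwistWord

end FreeTwist

/-! ### Evaluation of operations in a monoidal category with a monoid and a twist map. -/

section Interpretation

open FreeMonoidalCategory (project)
open TwistWord (eval gen)

variable {E : Type u} [Category.{v} E] [MonoidalCategory E] {K : E} [MonObj K]
  {t : K ⊗ K ⟶ K ⊗ K} (ht : IsTwistMap K t)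

/-- Evaluation is strictly monoidal by construction, but this becomes definitional only after a
representative of the class `f` has been chosen. -/
lemma eval_map_whiskerLeft (X : TwistWord) {Y Z : TwistWord} (f : Y ⟶ Z) :
    (eval ht).map (X ◁ f) = (eval ht).obj X ◁ (eval ht).map f := by
  obtain ⟨f⟩ := f
  rfl

lemma eval_map_whiskerRight {Y Z : TwistWord} (f : Y ⟶ Z) (X : TwistWord) :
    (eval ht).map (f ▷ X) = (eval ht).map f ▷ (eval ht).obj X := by
  obtain ⟨f⟩ := f
  rfl

lemma eval_map_tensorHom {X Y Z T : TwistWord} (f : X ⟶ Y) (g : Z ⟶ T) :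
    (eval ht).map (f ⊗ₘ g) = (eval ht).map f ⊗ₘ (eval ht).map g := by
  obtain ⟨f⟩ := f
  obtain ⟨g⟩ := g
  rfl

/-- The interpretation is compatible with finite tensor products. -/
def evalFinTensor : (n : ℕ) → (B : Fin n → TwistWord) →
    ((eval ht).obj (finTensor n B) ≅ finTensor n (fun i => (eval ht).obj (B i)))
  | 0, _ => Iso.refl (𝟙_ E)
  | n + 1, B => whiskerLeftIso ((eval ht).obj (B 0)) (evalFinTensor n (fun i => B i.succ))

lemma evalFinTensor_naturality : ∀ {n : ℕ} {B B' : Fin n → TwistWord} (g : ∀ i, B i ⟶ B' i),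
    (eval ht).map (finTensorMap g) ≫ (evalFinTensor ht n B').hom =
      (evalFinTensor ht n B).hom ≫ finTensorMap (fun i => (eval ht).map (g i))
  | 0, _, _, _ => (congrArg (· ≫ _) ((eval ht).map_id _)).trans
      ((Category.id_comp _).trans (Category.comp_id (𝟙 (𝟙_ E))).symm)
  | n + 1, B, B', g => by
    have ih := evalFinTensor_naturality (fun i : Fin n => g i.succ)
    refine (congrArg (· ≫ _) (eval_map_tensorHom ht (g 0)
      (finTensorMap fun i : Fin n => g i.succ))).trans ?_
    change (_ ⊗ₘ _) ≫ _ ◁ (evalFinTensor ht n fun i => B' i.succ).hom =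
      _ ◁ (evalFinTensor ht n fun i => B i.succ).hom ≫ (_ ⊗ₘ finTensorMap _)
    rw [tensorHom_comp_whiskerLeft, whiskerLeft_comp_tensorHom, ih]

/-- The interpretation is compatible with the evaluation of bracketed words. -/
def evalProject {ι : Type} (B : ι → TwistWord) : (X : FreeMonoidalCategory ι) →
    ((eval ht).obj ((project B).obj X) ⟶ (project fun i => (eval ht).obj (B i)).obj X)
  | .of i => 𝟙 ((eval ht).obj (B i))
  | .unit => 𝟙 (𝟙_ E)
  | .tensor X Y => evalProject B X ⊗ₘ evalProject B Y

/-- Both interpretations send each formal structural isomorphism to the corresponding one in `E`.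
Since this holds for every formal morphism, it applies to the chosen rebracketing `flatToNested`. -/
lemma evalProject_naturality {ι : Type} (B : ι → TwistWord) {X Y : FreeMonoidalCategory ι}
    (f : X ⟶ Y) :
    (eval ht).map ((project B).map f) ≫ evalProject ht B Y =
      evalProject ht B X ≫ (project fun i => (eval ht).obj (B i)).map f := by
  induction f using FreeMonoidalCategory.Hom.inductionOn with
  | id X => simp
  | α_hom X Y Z => exact (associator_naturality _ _ _).symm
  | α_inv X Y Z => exact (associator_inv_naturality _ _ _).symm
  | l_hom X =>
    change (λ_ _).hom ≫ evalProject ht B X = (𝟙 (𝟙_ E) ⊗ₘ evalProject ht B X) ≫ (λ_ _).hom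
    simp
  | l_inv X =>
    refine Eq.trans (b := (λ_ _).inv ≫ (𝟙 (𝟙_ E) ⊗ₘ evalProject ht B X)) rfl ?_
    rw [id_tensorHom]
    exact (leftUnitor_inv_naturality _).symm
  | ρ_hom X =>
    change (ρ_ _).hom ≫ evalProject ht B X = (evalProject ht B X ⊗ₘ 𝟙 (𝟙_ E)) ≫ (ρ_ _).hom
    simp
  | ρ_inv X =>
    refine Eq.trans (b := (ρ_ _).inv ≫ (evalProject ht B X ⊗ₘ 𝟙 (𝟙_ E))) rfl ?_
    rw [tensorHom_id]
    exact (rightUnitor_inv_naturality _).symm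
  | comp f h hf hh =>
    rw [Functor.map_comp, Functor.map_comp, Functor.map_comp, Category.assoc, hh,
      reassoc_of% hf]
  | @whiskerLeft X Y Z f hf =>
    have h : (eval ht).map ((project B).map (X ◁ f)) =
        (eval ht).obj ((project B).obj X) ◁ (eval ht).map ((project B).map f) :=
      (congrArg (eval ht).map (project_map_whiskerLeft B X f)).trans
        (eval_map_whiskerLeft ht _ _)
    rw [h, project_map_whiskerLeft]
    refine (whiskerLeft_comp_tensorHom (evalProject ht B X) ((eval ht).map ((project B).map f))
      (evalProject ht B Z)).trans (Eq.trans ?_ (tensorHom_comp_whiskerLeft (evalProject ht B X)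
      (evalProject ht B Y) ((project fun i => (eval ht).obj (B i)).map f)).symm)
    rw [hf]
  | @whiskerRight Y Z f X hf =>
    have h : (eval ht).map ((project B).map (f ▷ X)) =
        (eval ht).map ((project B).map f) ▷ (eval ht).obj ((project B).obj X) :=
      (congrArg (eval ht).map (project_map_whiskerRight B X f)).trans
        (eval_map_whiskerRight ht _ _)
    rw [h, project_map_whiskerRight]
    refine (whiskerRight_comp_tensorHom ((eval ht).map ((project B).map f))
      (evalProject ht B Z) (evalProject ht B X)).trans (Eq.trans ?_
      (tensorHom_comp_whiskerRight (evalProject ht B Y)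
        ((project fun i => (eval ht).obj (B i)).map f) (evalProject ht B X)).symm)
    rw [hf]

lemma evalProject_finTensor {ι : Type} (B : ι → TwistWord) :
    ∀ (n : ℕ) (W : Fin n → FreeMonoidalCategory ι),
    (eval ht).map (projectFinTensor B n W).hom ≫ (evalFinTensor ht n _).hom ≫
        finTensorMap (fun i => evalProject ht B (W i)) =
      evalProject ht B (finTensor n W) ≫ (projectFinTensor _ n W).hom
  | 0, _ => (congrArg (· ≫ _) ((eval ht).map_id _)).trans
      ((Category.id_comp _).trans rfl)
  | n + 1, W => by
    have ih := evalProject_finTensor B n (fun i => W i.succ)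
    refine (congrArg (· ≫ _) (eval_map_whiskerLeft ht ((project B).obj (W 0))
      (projectFinTensor B n fun i => W i.succ).hom)).trans ?_
    refine Eq.trans ?_ (tensorHom_comp_whiskerLeft (evalProject ht B (W 0))
      (evalProject ht B (finTensor n fun i => W i.succ))
      (projectFinTensor (fun i => (eval ht).obj (B i)) n fun i => W i.succ).hom).symm
    rw [← ih]
    change _ ◁ _ ≫ _ ◁ (evalFinTensor ht n _).hom ≫ (evalProject ht B (W 0) ⊗ₘ finTensorMap _) = _
    rw [whiskerLeft_comp_tensorHom, whiskerLeft_comp_tensorHom]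

lemma finTensorMap_evalFinTensor {n : ℕ} (m : Fin n → ℕ) (B : (Σ i, Fin (m i)) → TwistWord) :
    (fun i => (eval ht).map (projectFinTensor B (m i) (fun j => .of ⟨i, j⟩)).hom ≫
      (evalFinTensor ht (m i) (fun j => B ⟨i, j⟩)).hom) =
    (fun i => evalProject ht B (finTensor (m i) (fun j => .of ⟨i, j⟩)) ≫
      (projectFinTensor (fun s => (eval ht).obj (B s)) (m i) (fun j => .of ⟨i, j⟩)).hom) := by
  funext i
  rw [← evalProject_finTensor ht B (m i) (fun j => .of ⟨i, j⟩)]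
  -- On single letters `evalProject` is the identity.
  have h : finTensorMap (fun j => evalProject ht B (.of (⟨i, j⟩ : Σ i, Fin (m i)))) = 𝟙 _ :=
    finTensorMap_id (fun j => (eval ht).obj (B ⟨i, j⟩))
  exact congrArg (_ ≫ ·) ((congrArg (_ ≫ ·) h).trans (Category.comp_id _)).symm

lemma map_rebracketing_aux {C D : Type*} [Category* C] [Category* D] (F : C ⥤ D)
    {X₀ X₁ X₂ X₃ X₄ : C} {Y₀ Y₁ Y₂ Y₃ Y₄ Z₁ Z₂ : D}
    {i : X₀ ≅ X₁} {p : X₁ ⟶ X₂} {q : X₂ ⟶ X₃} {r : X₃ ⟶ X₄}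
    {i' : Y₀ ≅ Y₁} {p' : Y₁ ⟶ Y₂} {q' : Y₂ ⟶ Y₃} {r' : Y₃ ⟶ Y₄}
    {f₀ : F.obj X₀ ⟶ Y₀} {f₁ : F.obj X₁ ⟶ Y₁} {f₂ : F.obj X₂ ⟶ Y₂} {a : F.obj X₃ ⟶ Z₁}
    {b : Z₁ ⟶ Y₃} {c : F.obj X₄ ⟶ Z₂} {d : Z₂ ⟶ Y₄} {s : Z₁ ⟶ Z₂}
    (h₁ : F.map i.hom ≫ f₁ = f₀ ≫ i'.hom) (h₂ : F.map p ≫ f₂ = f₁ ≫ p')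
    (h₃ : F.map q ≫ a ≫ b = f₂ ≫ q') (h₄ : F.map r ≫ c = a ≫ s) (h₅ : s ≫ d = b ≫ r') :
    F.map (i.hom ≫ p ≫ q ≫ r) ≫ c ≫ d = f₀ ≫ i'.hom ≫ p' ≫ q' ≫ r' := by
  simp only [Functor.map_comp, Category.assoc]
  rw [reassoc_of% h₄, h₅, reassoc_of% h₃, reassoc_of% h₂, reassoc_of% h₁]

/-- The same formal morphism `flatToNested` underlies the rebracketing in `TwistWord` and in `E`;
the claim is the pasting of one square for each of the four constituents of `regroup`. -/
lemma eval_map_regroup {n : ℕ} (m : Fin n → ℕ) (B : (Σ i, Fin (m i)) → TwistWord) :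
    (eval ht).map (regroup m B) ≫ (evalFinTensor ht n _).hom ≫
        finTensorMap (fun i => (evalFinTensor ht (m i) (fun j => B ⟨i, j⟩)).hom) =
      (evalFinTensor ht (∑ i, m i) _).hom ≫ regroup m (fun s => (eval ht).obj (B s)) := by
  have h1 := evalProject_finTensor ht B (∑ i, m i) (fun l => .of (finSigmaFinEquiv.symm l))
  have h0 : finTensorMap (fun l => evalProject ht B (.of (finSigmaFinEquiv.symm l))) = 𝟙 _ :=
    finTensorMap_id (fun l => (eval ht).obj (B (finSigmaFinEquiv.symm l)))
  have h1' := (congrArg (_ ≫ ·) ((congrArg (_ ≫ ·) h0).trans (Category.comp_id _))).symm.trans h1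
  exact map_rebracketing_aux (eval ht)
    (i := (projectFinTensor B (∑ i, m i) (fun l => .of (finSigmaFinEquiv.symm l))).symm)
    (i' := (projectFinTensor (fun s => (eval ht).obj (B s)) (∑ i, m i)
      (fun l => .of (finSigmaFinEquiv.symm l))).symm)
    (inv_square_aux (i := (eval ht).mapIso (projectFinTensor B (∑ i, m i)
      (fun l => .of (finSigmaFinEquiv.symm l)))) h1').symm
    (evalProject_naturality ht B (flatToNested m))
    (evalProject_finTensor ht B n (fun i => finTensor (m i) (fun j => .of ⟨i, j⟩)))
    (evalFinTensor_naturality ht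
      (fun i => (projectFinTensor B (m i) (fun j => .of ⟨i, j⟩)).hom))
    ((finTensorMap_comp _ _).symm.trans
      ((congrArg finTensorMap (finTensorMap_evalFinTensor ht m B)).trans (finTensorMap_comp _ _)))

/-- The interpretation of an operation on a word. -/
def evalOperation {X : TwistWord} {n : ℕ} (f : tensorPow X n ⟶ X) :
    tensorPow ((eval ht).obj X) n ⟶ (eval ht).obj X :=
  (evalFinTensor ht n (fun _ => X)).inv ≫ (eval ht).map f

lemma evalFinTensor_hom_evalOperation {X : TwistWord} {n : ℕ} (f : tensorPow X n ⟶ X) :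
    (evalFinTensor ht n (fun _ => X)).hom ≫ evalOperation ht f = (eval ht).map f :=
  Iso.hom_inv_id_assoc _ _

lemma endComp_map_aux {C D : Type*} [Category* C] [Category* D] (F : C ⥤ D) {X₀ X₁ X₂ X₃ : C}
    {Y₀ Y₁ Y₂ Y₃ : D} {i : X₀ ⟶ X₁} {p : X₁ ⟶ X₂} {q : X₂ ⟶ X₃}
    {f₀ : F.obj X₀ ⟶ Y₀} {f₁ : F.obj X₁ ⟶ Y₂} {f₂ : F.obj X₂ ⟶ Y₃}
    {i' : Y₀ ⟶ Y₁} {j : Y₂ ⟶ Y₁} {p' : Y₁ ⟶ Y₃} {s : Y₂ ⟶ Y₃} {q' : Y₃ ⟶ F.obj X₃}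
    (h₁ : F.map i ≫ f₁ ≫ j = f₀ ≫ i') (h₂ : F.map p ≫ f₂ = f₁ ≫ s) (h₃ : j ≫ p' = s)
    (h₄ : f₂ ≫ q' = F.map q) : f₀ ≫ i' ≫ p' ≫ q' = F.map (i ≫ p ≫ q) := by
  rw [← reassoc_of% h₁, reassoc_of% h₃, ← reassoc_of% h₂, h₄, Functor.map_comp,
    Functor.map_comp]

/-- Evaluation respects each ingredient of `endComp`: rebracketing, tensor products and composition.
This is the source of multiplicativity of the action. -/
lemma evalOperation_endComp {X : TwistWord} {n : ℕ} (m : Fin n → ℕ) (f : tensorPow X n ⟶ X)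
    (g : ∀ i, tensorPow X (m i) ⟶ X) :
    evalOperation ht (endComp m f g) =
      endComp m (evalOperation ht f) (fun i => evalOperation ht (g i)) := by
  refine (Iso.inv_comp_eq _).2 (Eq.symm ?_)
  exact endComp_map_aux (eval ht) (eval_map_regroup ht m (fun _ => X))
    (evalFinTensor_naturality ht g)
    ((finTensorMap_comp _ _).symm.trans
      (congrArg finTensorMap (funext fun i => evalFinTensor_hom_evalOperation ht (g i))))
    (evalFinTensor_hom_evalOperation ht f)

lemma evalOperation_naturality {X Y : TwistWord} (a : X ⟶ Y) {n : ℕ} {f : tensorPow X n ⟶ X}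
    {g : tensorPow Y n ⟶ Y} (h : tensorPowMap a n ≫ g = f ≫ a) :
    tensorPowMap ((eval ht).map a) n ≫ evalOperation ht g =
      evalOperation ht f ≫ (eval ht).map a := by
  have h1 := evalFinTensor_naturality ht (fun _ : Fin n => a)
  have h2 := congrArg (eval ht).map h
  rw [Functor.map_comp, Functor.map_comp] at h2
  rw [evalOperation, evalOperation, Category.assoc, ← h2, ← cancel_epi (evalFinTensor ht n _).hom,
    ← reassoc_of% h1, Iso.hom_inv_id_assoc, Iso.hom_inv_id_assoc]

lemma evalOperation_rightUnitor (X : TwistWord) :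
    evalOperation ht (n := 1) (ρ_ X).hom = (ρ_ ((eval ht).obj X)).hom := by
  refine (Iso.inv_comp_eq _).2 (Eq.trans ?_ (congrArg (· ≫ _) (whiskerLeft_id _ _)).symm)
  exact (Category.id_comp (ρ_ ((eval ht).obj X)).hom).symm

/-- The interpretation of a tensor power of the generator. -/
def evalPow (a : ℕ) : (eval ht).obj (tensorPow gen a) ≅ tensorPow K a :=
  evalFinTensor ht a (fun _ => gen)

/-- Evaluation turns `insertUnit gen X` into `insertUnit K` by definition, so naturality of the
latter suffices. -/
lemma eval_map_insertUnit {X : TwistWord} {Y : E} (e : (eval ht).obj X ≅ Y) :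
    (eval ht).map (insertUnit gen X) ≫ K ◁ e.hom = e.hom ≫ insertUnit K Y :=
  (insertUnit_naturality K e.hom).symm

lemma eval_map_mulLeft {X : TwistWord} {Y : E} (e : (eval ht).obj X ≅ Y) :
    (eval ht).map (mulLeft gen X) ≫ K ◁ e.hom = K ◁ K ◁ e.hom ≫ mulLeft K Y :=
  (mulLeft_naturality K e.hom).symm

lemma comp_naturality_aux {C D : Type*} [Category* C] [Category* D] (F : C ⥤ D) {X₀ X₁ X₂ : C}
    {Y₀ Y₁ Y₂ : D} {f : X₀ ⟶ X₁} {f' : X₁ ⟶ X₂} {h : Y₀ ⟶ Y₁} {h' : Y₁ ⟶ Y₂}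
    {g₀ : F.obj X₀ ⟶ Y₀} {g₁ : F.obj X₁ ⟶ Y₁} {g₂ : F.obj X₂ ⟶ Y₂}
    (h₁ : F.map f ≫ g₁ = g₀ ≫ h) (h₂ : F.map f' ≫ g₂ = g₁ ≫ h') :
    F.map (f ≫ f') ≫ g₂ = g₀ ≫ h ≫ h' := by
  rw [Functor.map_comp, Category.assoc, h₂, reassoc_of% h₁]

/-- The cobar construction of `gen` evaluates to that of `K`, by the common recursion that defines
both. -/
lemma eval_map_monotoneTensor (a b : ℕ) (f : Fin a →o Fin b) :
    (eval ht).map (monotoneTensor gen a b f) ≫ (evalPow ht b).hom =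
      (evalPow ht a).hom ≫ monotoneTensor K a b f := by
  induction hN : a + b using Nat.strong_induction_on generalizing a b with
  | _ N ih =>
  subst hN
  match b, a with
  | 0, a + 1 => exact (f 0).elim0
  | 0, 0 =>
    rw [monotoneTensor, monotoneTensor, CategoryTheory.Functor.map_id, Category.id_comp,
      Category.comp_id]
  | b + 1, a =>
    by_cases h : ∀ i, f i ≠ 0
    · rw [monotoneTensor_of_ne gen f h, monotoneTensor_of_ne K f h]
      exact comp_naturality_aux (eval ht) (ih _ (by lia) a b (predMap f h) rfl)
        (eval_map_insertUnit ht (evalPow ht b))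
    · match a with
      | 0 => exact absurd (fun i => i.elim0) h
      | a + 1 =>
        have h0 : f 0 = 0 := by
          by_contra h0
          exact h (ne_zero_of_zero f h0)
        have ih' := ih _ (by lia) a (b + 1) (tailMap f) rfl
        rw [monotoneTensor_of_zero gen f h0, monotoneTensor_of_zero K f h0]
        have hm : (eval ht).map (mulLeft gen (tensorPow gen b)) ≫ (evalPow ht (b + 1)).hom =
            K ◁ (evalPow ht (b + 1)).hom ≫ mulLeft K (tensorPow K b) :=
          eval_map_mulLeft ht (evalPow ht b)
        refine comp_naturality_aux (eval ht) ?_ hm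
        refine (congrArg (· ≫ _) (eval_map_whiskerLeft ht gen _)).trans ?_
        exact (whiskerLeft_comp _ _ _).symm.trans
          ((congrArg (K ◁ ·) ih').trans (whiskerLeft_comp _ _ _))

lemma conjugate_naturality {A B : E} (e : A ≅ B) {n : ℕ} (f : tensorPow A n ⟶ A) :
    tensorPowMap e.hom n ≫ tensorPowMap e.inv n ≫ f ≫ e.hom = f ≫ e.hom := by
  rw [← Category.assoc, ← tensorPowMap_comp, e.hom_inv_id, tensorPowMap_id,
    Category.id_comp]

instance isIso_tensorPowMap {A B : E} (e : A ⟶ B) [IsIso e] (n : ℕ) : IsIso (tensorPowMap e n) :=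
  ⟨tensorPowMap (inv e) n, by rw [← tensorPowMap_comp, IsIso.hom_inv_id,
    tensorPowMap_id], by rw [← tensorPowMap_comp, IsIso.inv_hom_id,
    tensorPowMap_id]⟩

/-- The interpretation of an operation on a tensor power of the generator. -/
def evalPowOperation {a n : ℕ} (f : tensorPow (tensorPow gen a) n ⟶ tensorPow gen a) :
    tensorPow (tensorPow K a) n ⟶ tensorPow K a :=
  tensorPowMap (evalPow ht a).inv n ≫ evalOperation ht f ≫ (evalPow ht a).hom

lemma tensorPowMap_evalPowOperation {a n : ℕ}
    (f : tensorPow (tensorPow gen a) n ⟶ tensorPow gen a) :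
    tensorPowMap (evalPow ht a).hom n ≫ evalPowOperation ht f =
      evalOperation ht f ≫ (evalPow ht a).hom :=
  conjugate_naturality _ _

/-- The isomorphism `evalPow` intertwines `evalOperation` and `evalPowOperation`, and `endComp`
respects intertwined operations; the invertible power of `evalPow` is then cancelled. -/
lemma evalPowOperation_endComp {a n : ℕ} (m : Fin n → ℕ)
    (f : tensorPow (tensorPow gen a) n ⟶ tensorPow gen a)
    (g : ∀ i, tensorPow (tensorPow gen a) (m i) ⟶ tensorPow gen a) :
    evalPowOperation ht (endComp m f g) =
      endComp m (evalPowOperation ht f) (fun i => evalPowOperation ht (g i)) := by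
  rw [← cancel_epi (tensorPowMap (evalPow ht a).hom _), tensorPowMap_evalPowOperation,
    evalOperation_endComp]
  exact (endComp_naturality _ m (tensorPowMap_evalPowOperation ht f)
    (fun i => tensorPowMap_evalPowOperation ht (g i))).symm

lemma evalPowOperation_rightUnitor (a : ℕ) :
    evalPowOperation ht (n := 1) (ρ_ (tensorPow gen a)).hom = (ρ_ (tensorPow K a)).hom := by
  have h := rightUnitor_naturality (evalPow ht a).hom
  rw [← tensorHom_id] at h
  refine (cancel_epi (tensorPowMap (evalPow ht a).hom 1)).1 ?_
  exact (tensorPowMap_evalPowOperation ht _).trans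
    ((congrArg (· ≫ _) (evalOperation_rightUnitor ht _)).trans h.symm)

lemma evalPowOperation_naturality {a b n : ℕ} (θ : Fin a →o Fin b)
    {f : tensorPow (tensorPow gen a) n ⟶ tensorPow gen a}
    {g : tensorPow (tensorPow gen b) n ⟶ tensorPow gen b}
    (h : tensorPowMap (monotoneTensor gen a b θ) n ≫ g = f ≫ monotoneTensor gen a b θ) :
    tensorPowMap (monotoneTensor K a b θ) n ≫ evalPowOperation ht g =
      evalPowOperation ht f ≫ monotoneTensor K a b θ := by
  have h1 := evalOperation_naturality ht _ h
  have h2 := eval_map_monotoneTensor ht a b θ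
  rw [← cancel_epi (tensorPowMap (evalPow ht a).hom n), ← Category.assoc,
    ← tensorPowMap_comp, ← h2, tensorPowMap_comp, Category.assoc,
    tensorPowMap_evalPowOperation, reassoc_of% h1, h2,
    ← Category.assoc (tensorPowMap (evalPow ht a).hom n), tensorPowMap_evalPowOperation,
    Category.assoc]

end Interpretation

/-! ### The action of `TW` on cobar constructions. -/

section Action

open TwistWord (gen)

variable {E : Type u} [Category.{v} E] [MonoidalCategory E] {K : E} [MonObj K]
  {t : K ⊗ K ⟶ K ⊗ K}

/-- The operad `TW` that acts on the cobar constructions of monoids with a twist map: the operad of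
augmented endomorphisms of the universal cobar construction. -/
noncomputable def twistOperad : SimplicialOperad.{0} := augOperad gen

/-- Cosimplicial degree `j` corresponds to the index `a = j + 1` of an `AugSimplex`. The augmented
degree `a = 0` is forgotten, and `unital` plays no role in the action. -/
lemma twistAction_naturality (ht : IsTwistMap K t) {n : ℕ} {k : SimplexCategoryᵒᵖ}
    (φ : AugSimplex gen n (k.unop.len + 1)) {j j' : SimplexCategory} (f : j ⟶ j')
    (s : (simplexFunctor.obj k.unop).obj (op j')) :
    (cosimplicialPow (cobar K) n).map f ≫ evalPowOperation ht
        (φ.component (j'.len + 1) (SSet.stdSimplex.objEquiv s).toOrderHom) =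
      evalPowOperation ht (φ.component (j.len + 1) (SSet.stdSimplex.objEquiv
        ((simplexFunctor.obj k.unop).map f.op s)).toOrderHom) ≫ (cobar K).map f :=
  evalPowOperation_naturality ht f.toOrderHom
    (φ.naturality f.toOrderHom (SSet.stdSimplex.objEquiv s).toOrderHom)

variable [HasLimitsOfSize.{0, 0} E]

/-- The action of a simplex of `TW` on a cobar construction. -/
noncomputable def twistAction (ht : IsTwistMap K t) {n : ℕ} {k : SimplexCategoryᵒᵖ}
    (φ : AugSimplex gen n (k.unop.len + 1)) :
    (mapSpace (cosimplicialPow (cobar K) n) (cobar K)).obj k :=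
  mapSpace.mk
    (fun j s => evalPowOperation ht
      (φ.component (j.len + 1) (SSet.stdSimplex.objEquiv s).toOrderHom))
    (twistAction_naturality ht φ)

lemma component_twistAction (ht : IsTwistMap K t) {n : ℕ} {k : SimplexCategoryᵒᵖ}
    (φ : AugSimplex gen n (k.unop.len + 1)) (j : SimplexCategory)
    (s : (simplexFunctor.obj k.unop).obj (op j)) :
    mapSpace.component (twistAction ht φ) j s =
      evalPowOperation ht
        (φ.component (j.len + 1) (SSet.stdSimplex.objEquiv s).toOrderHom) :=
  mapSpace.component_mk _ (twistAction_naturality ht φ) j s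

/-- The action of `TW` on a cobar construction. -/
noncomputable def twistOperadHom (ht : IsTwistMap K t) :
    twistOperad.Hom (endOperad (cobar K)) where
  app _ _ φ := twistAction ht φ
  naturality n k l θ φ := by
    apply mapSpace.ext
    intro j s
    refine (component_twistAction ht _ j s).trans (Eq.trans ?_
      (mapSpace.component_map _ θ j s).symm)
    exact (component_twistAction ht φ j _).symm
  map_one k := by
    apply mapSpace.ext
    intro j s
    refine (component_twistAction ht _ j s).trans (Eq.trans ?_
      (component_endUnit (cobar K) k j s).symm)
    exact evalPowOperation_rightUnitor ht (j.len + 1)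
  map_comp m x y := by
    apply mapSpace.ext
    intro j s
    refine (component_twistAction ht _ j s).trans (Eq.trans ?_
      (component_endComposite (cobar K) m _ _ j s).symm)
    refine (evalPowOperation_endComp ht m _ _).trans ?_
    exact congrArg₂ (endComp m) (component_twistAction ht x j s).symm
      (funext fun i => (component_twistAction ht (y i) j s).symm)

end Action

end TwistOperad

theorem theorem1p2 :
    ∃ TW : TwistOperad.SimplicialOperad.{0}, TW.IsAInfinity ∧
      ∀ (E : Type u) [Category.{v} E] [MonoidalCategory E] [HasLimitsOfSize.{0, 0} E]
        [HasColimitsOfSize.{0, 0} E] (K : E) [MonObj K] (t : K ⊗ K ⟶ K ⊗ K),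
        TwistOperad.IsTwistMap K t →
          Nonempty (TW.Hom (TwistOperad.endOperad (TwistOperad.cobar K))) := by
  refine ⟨TwistOperad.twistOperad, fun n => ?_, fun E _ _ _ _ K _ t ht => ?_⟩
  -- Contractibility is applied to the universal twist map alone.
  · exact TwistOperad.contractibleSpace_augSpace TwistOperad.TwistWord.isTwistMap_genTwist n
  · exact ⟨TwistOperad.twistOperadHom ht⟩
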